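/- Let $b\ge 2$ be an integer, let $d\ge 1$, let $X=\mathbb{R}^d$, and let $\mathcal{L}(X)$ be the space of all linear maps $X\to X$. Let $\varphi$ be a linear flow on $X$, i.e. a continuous map $\varphi:\mathbb{R}\times X\to X$ such that, with $\varphi_t:=\varphi(t,\cdot)$, one has $\varphi_0=\mathrm{id}_X$, $\varphi_{s}\circ\varphi_t=\varphi_{s+t}$ and $\varphi_t\in\mathcal{L}(X)$ for all $s,t\in\mathbb{R}$. Let $A_\varphi=\frac{d}{dt}\varphi_t|_{t=0}\in\mathcal{L}(X)$ be its generator and let the spectrum $\sigma(\varphi)\subset\mathbb{C}$ be the set of all complex eigenvalues of $A_\varphi$. Significands and Benford functions. For real $x\neq 0$ let $S_b(x)$ be the unique number in $[1,b)$ with $|x|=S_b(x)\,b^k$ for some $k\in\mathbb{Z}$, and let $S_b(0)=0$. A Borel measurable function $f:[0,\infty)\to\mathbb{R}$ is called $b$-Benford if $$\lim_{T\to+\infty}\frac{\lambda(\{t\in[0,T]: S_b(f(t))\le s\})}{T}=\log_b s\qquad\text{for all } s\in[1,b),$$ where $\lambda$ is Lebesgue measure. Nonresonance. For $r>0$, a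 non-empty set $Z\subset\{z\in\mathbb{C}:|z|=r\}$ is $b$-nonresonant if the set $$\Delta_Z=\Big\{1+\frac{\arg z-\arg w}{2\pi}: z,w\in Z\Big\}\qquad(\arg\in(-\pi,\pi])$$ satisfies $\Delta_Z\cap\mathbb{Q}=\{1\}$ and $\log_b r\notin\mathrm{span}_{\mathbb{Q}}\Delta_Z$. An arbitrary set $Z\subset\mathbb{C}$ is $b$-nonresonant if for every $r>0$ the set $Z\cap\{|z|=r\}$ is either empty or $b$-nonresonant. A set $Z\subset\mathbb{C}$ is exponentially $b$-nonresonant if the set $\{e^{tz}:z\in Z\}$ is $b$-nonresonant for some real $t\ge 0$. Then the following are equivalent: (i) the spectrum $\sigma(\varphi)$ is exponentially $b$-nonresonant; (ii) for every linear functional $H:\mathcal{L}(X)\to\mathbb{R}$, either the function $t\mapsto H(\varphi_t)$ on $[0,\infty)$ is $b$-Benford, or $H(\varphi_t)=0$ for all $t\in\mathbb{R}$. -/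

import Mathlib

open MeasureTheory Filter Topology

/-! ### Significands and Benford functions -/

/-- The significand `S_b(x)`: the number in `[1, b)` with `|x| = S_b(x) * b ^ k` for some integer
`k` if `x ≠ 0` (see `eq_significand_iff`), and `S_b(0) = 0`. -/
noncomputable def significand (b : ℕ) (x : ℝ) : ℝ :=
  |x| / (b : ℝ) ^ ⌊Real.logb b |x|⌋

theorem significand_zero (b : ℕ) : significand b 0 = 0 := by
  simp [significand]

theorem eq_significand_iff {b : ℕ} (hb : 2 ≤ b) {x : ℝ} (hx : x ≠ 0) (s : ℝ) :
    s = significand b x ↔ 1 ≤ s ∧ s < b ∧ ∃ k : ℤ, |x| = s * (b : ℝ) ^ k := by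
  have hb1 : (1 : ℝ) < b := by exact_mod_cast hb
  have hb0 : (0 : ℝ) < b := by linarith
  have hx0 : 0 < |x| := abs_pos.mpr hx
  constructor
  · rintro rfl
    have hp : (0 : ℝ) < (b : ℝ) ^ ⌊Real.logb b |x|⌋ := zpow_pos hb0 _
    refine ⟨?_, ?_, ⌊Real.logb b |x|⌋, ?_⟩
    · rw [significand, le_div_iff₀ hp, one_mul, ← Real.rpow_intCast,
        ← Real.le_logb_iff_rpow_le hb1 hx0]
      exact Int.floor_le _
    · rw [significand, div_lt_iff₀ hp, ← zpow_one_add₀ hb0.ne', ← Real.rpow_intCast,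
        ← Real.logb_lt_iff_lt_rpow hb1 hx0]
      push_cast
      linarith [Int.lt_floor_add_one (Real.logb b |x|)]
    · rw [significand, div_mul_cancel₀ _ hp.ne']
  · rintro ⟨h1, h2, k, hk⟩
    have hs0 : 0 < s := by linarith
    have hf : ⌊Real.logb b |x|⌋ = k := by
      rw [hk, Real.logb_mul hs0.ne' (zpow_pos hb0 k).ne', ← Real.rpow_intCast,
        Real.logb_rpow hb0 hb1.ne', Int.floor_add_intCast]
      have : ⌊Real.logb b s⌋ = 0 := by
        rw [Int.floor_eq_zero_iff]
        refine ⟨Real.logb_nonneg hb1 h1, ?_⟩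
        rw [Real.logb_lt_iff_lt_rpow hb1 hs0, Real.rpow_one]
        exact h2
      omega
    rw [significand, hf, hk, mul_div_assoc, div_self (zpow_pos hb0 k).ne', mul_one]

/-- A function on `[0, ∞)` is `b`-Benford if it is Borel measurable and, for every `s ∈ [1, b)`,
the proportion of times `t ∈ [0, T]` with `S_b (f t) ≤ s` tends to `log_b s` as `T → ∞`.
Only the values of `f` on `[0, ∞)` matter. -/
def IsBenfordFunction (b : ℕ) (f : ℝ → ℝ) : Prop :=
  Measurable ((Set.Ici (0 : ℝ)).domRestrict f) ∧
    ∀ s ∈ Set.Ico (1 : ℝ) b,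
      Tendsto (fun T : ℝ => volume.real {t : ℝ | t ∈ Set.Icc 0 T ∧ significand b (f t) ≤ s} / T)
        atTop (𝓝 (Real.logb b s))

/-! ### Nonresonance -/

/-- The set `Δ_Z = {1 + (arg z - arg w) / (2π) : z, w ∈ Z}`, with `arg` valued in `(-π, π]`. -/
def argDifferences (Z : Set ℂ) : Set ℝ :=
  {x : ℝ | ∃ z ∈ Z, ∃ w ∈ Z, x = 1 + (z.arg - w.arg) / (2 * Real.pi)}

/-- `b`-nonresonance of a non-empty set contained in the circle `{|z| = r}`. -/
def IsCircleNonresonant (b : ℕ) (r : ℝ) (Z : Set ℂ) : Prop :=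
  Z.Nonempty ∧ Z ⊆ Metric.sphere (0 : ℂ) r ∧
    argDifferences Z ∩ Set.range ((↑) : ℚ → ℝ) = {1} ∧
    Real.logb b r ∉ Submodule.span ℚ (argDifferences Z)

/-- `b`-nonresonance of an arbitrary set of complex numbers. -/
def IsNonresonant (b : ℕ) (Z : Set ℂ) : Prop :=
  ∀ r : ℝ, 0 < r → IsCircleNonresonant b r (Z ∩ Metric.sphere (0 : ℂ) r) ∨
    Z ∩ Metric.sphere (0 : ℂ) r = ∅

/-- `Z` is exponentially `b`-nonresonant if `e^{tZ} = {e^{tz} : z ∈ Z}` is `b`-nonresonant for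
some `t ≥ 0`. -/
def IsExpNonresonant (b : ℕ) (Z : Set ℂ) : Prop :=
  ∃ t : ℝ, 0 ≤ t ∧ IsNonresonant b ((fun z : ℂ => Complex.exp (t * z)) '' Z)

/-! ### Linear flows -/

/-- A linear flow: a (continuous) flow each of whose time-`t` maps is linear. -/
structure LinearFlow (X : Type*) [NormedAddCommGroup X] [NormedSpace ℝ X] extends Flow ℝ X where
  isLinear' : ∀ t : ℝ, IsLinearMap ℝ (toFun t)

namespace LinearFlow

variable {X : Type*} [NormedAddCommGroup X] [NormedSpace ℝ X] (φ : LinearFlow X)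

/-- The time-`t` map `φ_t` as an element of the space of linear maps of `X`. (For
finite-dimensional `X`, every linear map is continuous, so `X →L[ℝ] X` is the space of all
linear maps.) -/
def timeMap (t : ℝ) : X →L[ℝ] X where
  toLinearMap := (φ.isLinear' t).mk' _
  cont := φ.cont'.comp (Continuous.prodMk_right t)

/-- The generator `A_φ = d/dt φ_t |_{t = 0}`. The derivative exists and `φ_t = e^{t A_φ}`,
see `hasDerivAt_timeMap` and `timeMap_eq_exp`. -/
noncomputable def generator : X →L[ℝ] X :=
  deriv φ.timeMap 0

/-- The spectrum of a linear flow: the complex eigenvalues of its generator, i.e. the eigenvalues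
of the complexification of the generator. -/
def spectrum : Set ℂ :=
  {z : ℂ | Module.End.HasEigenvalue
    (LinearMap.baseChange ℂ (φ.generator : X →ₗ[ℝ] X) : Module.End ℂ (TensorProduct ℝ ℂ X)) z}

theorem timeMap_apply (t : ℝ) (x : X) : φ.timeMap t x = φ.toFun t x := rfl

theorem timeMap_add (s t : ℝ) : φ.timeMap (s + t) = φ.timeMap s * φ.timeMap t := by
  ext x
  exact φ.map_add' s t x

theorem timeMap_zero : φ.timeMap 0 = 1 := by
  ext x
  exact φ.map_zero' x

theorem continuous_timeMap [FiniteDimensional ℝ X] : Continuous φ.timeMap := by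
  rw [continuous_clm_apply]
  intro x
  exact φ.cont'.comp (Continuous.prodMk_left x)

theorem differentiable_timeMap [FiniteDimensional ℝ X] : Differentiable ℝ φ.timeMap := by
  have : CompleteSpace X := FiniteDimensional.complete ℝ X
  have hc := φ.continuous_timeMap
  have hi : ∀ a b : ℝ, IntervalIntegrable φ.timeMap volume a b := fun a b =>
    hc.intervalIntegrable a b
  have hder : ∀ t : ℝ, HasDerivAt (fun t => ∫ s in (0 : ℝ)..t, φ.timeMap s) (φ.timeMap t) t :=
    fun t => hc.integral_hasStrictDerivAt 0 t |>.hasDerivAt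
  -- the average of `φ` over a short time interval is invertible
  have hlim : Tendsto (fun h : ℝ => h⁻¹ • ∫ s in (0 : ℝ)..h, φ.timeMap s) (𝓝[≠] 0) (𝓝 1) := by
    have := (hasDerivAt_iff_tendsto_slope_zero.mp (hder 0))
    simpa [timeMap_zero] using this
  obtain ⟨h, hu, hh⟩ := ((hlim.eventually (Units.isOpen.mem_nhds isUnit_one)).and
    self_mem_nhdsWithin).exists
  obtain ⟨u, hu⟩ := hu
  have key : φ.timeMap = fun t => (h⁻¹ • ((∫ s in (0 : ℝ)..(t + h), φ.timeMap s) -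
      ∫ s in (0 : ℝ)..t, φ.timeMap s)) * (↑u⁻¹ : X →L[ℝ] X) := by
    funext t
    rw [Units.eq_mul_inv_iff_mul_eq, hu, mul_smul_comm,
      intervalIntegral.integral_interval_sub_left (hi _ _) (hi _ _)]
    congr 1
    have h1 : ∫ s in t..(t + h), φ.timeMap s = ∫ s in (0 : ℝ)..h, φ.timeMap (t + s) := by
      rw [intervalIntegral.integral_comp_add_left, add_zero]
    rw [h1]
    simp_rw [timeMap_add]
    exact (ContinuousLinearMap.intervalIntegral_comp_comm
      (ContinuousLinearMap.mul ℝ (X →L[ℝ] X) (φ.timeMap t)) (hi 0 h)).symm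
  rw [key]
  intro t
  have h2 : HasDerivAt (fun t => ∫ s in (0 : ℝ)..(t + h), φ.timeMap s) (φ.timeMap (t + h)) t :=
    (hder (t + h)).comp_add_const t h
  exact (((h2.sub (hder t)).const_smul h⁻¹).mul_const _).differentiableAt

theorem hasDerivAt_timeMap [FiniteDimensional ℝ X] :
    HasDerivAt φ.timeMap φ.generator 0 :=
  (φ.differentiable_timeMap 0).hasDerivAt

theorem timeMap_eq_exp [FiniteDimensional ℝ X] (t : ℝ) :
    φ.timeMap t = NormedSpace.exp (t • φ.generator) := by
  have : CompleteSpace X := FiniteDimensional.complete ℝ X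
  have hd : ∀ t : ℝ, HasDerivAt φ.timeMap (φ.timeMap t * φ.generator) t := by
    intro t
    have h0 : HasDerivAt φ.timeMap φ.generator (t - t) := by
      rw [sub_self]; exact φ.hasDerivAt_timeMap
    have h1 : HasDerivAt (fun s => φ.timeMap t * φ.timeMap (s - t))
        (φ.timeMap t * φ.generator) t := (h0.comp_sub_const t t).const_mul (φ.timeMap t)
    convert h1 using 1
    funext s
    rw [← timeMap_add, add_sub_cancel]
  have he : ∀ t : ℝ, HasDerivAt (fun s : ℝ => NormedSpace.exp (s • (-φ.generator)))
      ((-φ.generator) * NormedSpace.exp (t • (-φ.generator))) t := fun t =>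
    hasDerivAt_exp_smul_const' (𝕂 := ℝ) (-φ.generator) t
  have hp : ∀ t : ℝ, HasDerivAt
      (fun s : ℝ => φ.timeMap s * NormedSpace.exp (s • (-φ.generator))) 0 t := by
    intro t
    refine ((hd t).mul (he t)).congr_deriv ?_
    rw [neg_mul, mul_neg, ← mul_assoc, add_neg_cancel]
  have hconst := is_const_of_deriv_eq_zero (fun t => (hp t).differentiableAt)
    (fun t => (hp t).deriv) t 0
  simp only [timeMap_zero, zero_smul, NormedSpace.exp_zero, mul_one] at hconst
  have hinv : NormedSpace.exp (t • (-φ.generator)) * NormedSpace.exp (t • φ.generator) = 1 := by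
    let _ : NormedAlgebra ℚ (X →L[ℝ] X) := NormedAlgebra.restrictScalars ℚ ℝ _
    rw [← NormedSpace.exp_add_of_commute, smul_neg, neg_add_cancel, NormedSpace.exp_zero]
    rw [smul_neg]
    exact (Commute.refl _).neg_left
  calc φ.timeMap t
      = φ.timeMap t * (NormedSpace.exp (t • (-φ.generator)) *
          NormedSpace.exp (t • φ.generator)) := by rw [hinv, mul_one]
    _ = NormedSpace.exp (t • φ.generator) := by rw [← mul_assoc, hconst, one_mul]

end LinearFlow

/-! For a finite set of exponents, nonresonance is a rational independence statement: for every `z`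
in the set, `Re z / log b` avoids the ℚ-span of the differences `(Im w - Im w') / 2π` over exponents
with the same real part as `z` (`isExpNonresonant_iff`). Weyl's criterion turns the Benford property
of `f` into the vanishing, in time average, of `exp (2πi h log_b |f|)` for every integer `h ≠ 0`.

Nonresonance implies Benford. Each `H (φ_t)` is an exponential polynomial with exponents in the
spectrum. If it is nonzero, it is asymptotic to `e^(at) t^k g(t)` with `g` a nonzero trigonometric
polynomial. Off a set of times of small density, where `g` is nearly zero, the character of `log_b
|f|` is close to `exp (i(ωt + κ log t))` times a continuous function of `|g|²`. By Weierstrass the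
latter is nearly a trigonometric polynomial with frequencies in the group generated by the
differences of the frequencies of `g`. Nonresonance keeps `ω` out of that group, so no constant term
survives averaging (`isBenfordFunction_of_asymptotic`).

Benford implies nonresonance. Clearing denominators in a rational relation gives `τ a = ∑ k_j η_j`
with `τ = 2πM / log b`, `M ≠ 0`, `k_j ≥ 0`, `∑ k_j` even, and `±η_j` imaginary parts of eigenvalues
with real part `a`. All functions `f_z(t) = e^(at) Re ∑ z_j e^(iη_j t)` have the form `H (φ_t)`. Let
`z` be a standard complex Gaussian vector. The relation and rotation invariance make the expectation
of `∏ z_j^(k_j) |f_z(t)|^(iτ)` independent of `t`; if every `f_z` were Benford or zero, time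
averaging and dominated convergence would make it `0`. It is not `0`
(`integral_prod_coord_pow_mul_absCPow_ne_zero`): averaging over roots of unity reduces it to a
single complex Gaussian, where it splits into a Gamma value and a Fourier coefficient obeying a
two-step recursion. -/

section

open ProbabilityTheory
open scoped Real

/-! ### The character `|x|^(iτ)` and its radial and angular integrals -/

/-- The unitary character `x ↦ |x| ^ (iτ)` of the multiplicative group `ℝ \ {0}`. -/
noncomputable def absCPow (τ x : ℝ) : ℂ := ((|x| : ℝ) : ℂ) ^ (τ * Complex.I)

theorem absCPow_mul (τ x y : ℝ) : absCPow τ (x * y) = absCPow τ x * absCPow τ y := by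
  rw [absCPow, absCPow, absCPow, abs_mul, Complex.ofReal_mul,
    Complex.mul_cpow_ofReal_nonneg (abs_nonneg _) (abs_nonneg _)]

theorem absCPow_zero {τ : ℝ} (hτ : τ ≠ 0) : absCPow τ 0 = 0 := by
  simp [absCPow, hτ]

theorem absCPow_of_ne_zero (τ : ℝ) {x : ℝ} (hx : x ≠ 0) :
    absCPow τ x = Complex.exp (τ * Real.log |x| * Complex.I) := by
  rw [absCPow, Complex.cpow_def_of_ne_zero (by simpa using hx), ← Complex.ofReal_log (abs_nonneg x)]
  ring_nf

theorem norm_absCPow_le (τ x : ℝ) : ‖absCPow τ x‖ ≤ 1 := by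
  by_cases hx : x = 0
  · subst hx
    by_cases hτ : τ = 0
    · simp [absCPow, hτ]
    · simp [absCPow_zero hτ]
  · rw [absCPow_of_ne_zero τ hx]
    rw [show (τ * Real.log |x| * Complex.I : ℂ) = ((τ * Real.log |x| : ℝ) : ℂ) * Complex.I by
      push_cast; rfl, Complex.norm_exp_ofReal_mul_I]

theorem measurable_absCPow (τ : ℝ) : Measurable (absCPow τ) := by
  unfold absCPow; fun_prop

/-- The factor `x` removes the oscillating discontinuity at the origin. This lets an antiderivative
built from `|cos θ|^(iτ) cos θ` be integrated across the zeros of the cosine. -/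
theorem continuous_absCPow_mul_self (τ : ℝ) : Continuous fun x : ℝ => absCPow τ x * x := by
  rw [continuous_iff_continuousAt]
  intro x
  by_cases hx : x = 0
  · subst hx
    rw [ContinuousAt, Complex.ofReal_zero, mul_zero]
    apply squeeze_zero_norm (a := fun x : ℝ => |x|)
    · intro x
      rw [norm_mul, Complex.norm_real, Real.norm_eq_abs]
      exact mul_le_of_le_one_left (abs_nonneg _) (norm_absCPow_le τ x)
    · simpa using (continuous_abs.tendsto (0 : ℝ))
  · refine ContinuousAt.mul ?_ Complex.continuous_ofReal.continuousAt
    have : (fun x : ℝ => Complex.exp (τ * Real.log |x| * Complex.I)) =ᶠ[𝓝 x] absCPow τ := by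
      filter_upwards [isOpen_ne.mem_nhds hx] with y hy
      exact (absCPow_of_ne_zero τ hy).symm
    refine ContinuousAt.congr ?_ this
    simp_rw [Real.log_abs]
    have := Real.continuousAt_log hx
    fun_prop

theorem hasDerivAt_absCPow_mul_self (τ : ℝ) {x : ℝ} (hx : x ≠ 0) :
    HasDerivAt (fun x : ℝ => absCPow τ x * x) ((τ * Complex.I + 1) * absCPow τ x) x := by
  have h1 : HasDerivAt (fun x : ℝ => Complex.exp (τ * Real.log x * Complex.I) * x)
      (Complex.exp (τ * Real.log x * Complex.I) * (τ * ((x⁻¹ : ℝ) : ℂ) * Complex.I) * x +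
        Complex.exp (τ * Real.log x * Complex.I) * ((1 : ℝ) : ℂ)) x :=
    ((((Real.hasDerivAt_log hx).ofReal_comp.const_mul (τ : ℂ)).mul_const Complex.I).cexp).mul
      (hasDerivAt_id x).ofReal_comp
  have h2 : (fun x : ℝ => absCPow τ x * x) =ᶠ[𝓝 x]
      fun x : ℝ => Complex.exp (τ * Real.log x * Complex.I) * x := by
    filter_upwards [isOpen_ne.mem_nhds hx] with y hy
    rw [absCPow_of_ne_zero τ hy, Real.log_abs]
  refine (h1.congr_of_eventuallyEq h2).congr_deriv ?_
  rw [absCPow_of_ne_zero τ hx, Real.log_abs]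
  have : (x : ℂ) ≠ 0 := by exact_mod_cast hx
  push_cast
  field_simp

/-- Substituting `r² / 2` for the variable gives a nonzero multiple of `Γ(s / 2)`, and `Γ` has no
zeros in the right half-plane. -/
theorem integral_cpow_mul_exp_neg_sq_ne_zero {s : ℂ} (hs : 0 < s.re) :
    ∫ r in Set.Ioi (0 : ℝ), (r : ℂ) ^ (s - 1) * Complex.exp (-(r : ℂ) ^ 2 / 2) ≠ 0 := by
  have h1 := mellin_comp_rpow (fun t : ℝ => (Real.exp (-t) : ℂ)) s 2
  have h2 := mellin_comp_mul_left (fun t : ℝ => ((Real.exp (-(t ^ (2 : ℝ))) : ℝ) : ℂ)) s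
    (show (0 : ℝ) < (√2)⁻¹ by positivity)
  rw [h1, ← Complex.GammaIntegral_eq_mellin, ← Complex.Gamma_eq_integral (by simpa using hs)] at h2
  have h3 : mellin (fun t : ℝ => ((Real.exp (-(((√2)⁻¹ * t) ^ (2 : ℝ))) : ℝ) : ℂ)) s =
      ∫ r in Set.Ioi (0 : ℝ), (r : ℂ) ^ (s - 1) * Complex.exp (-(r : ℂ) ^ 2 / 2) := by
    rw [mellin]
    congr 1 with r
    rw [smul_eq_mul, Real.rpow_two, mul_pow, inv_pow, Real.sq_sqrt (by norm_num)]
    push_cast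
    ring_nf
  rw [← h3, h2]
  refine mul_ne_zero ?_ (smul_ne_zero (by norm_num) (Complex.Gamma_ne_zero_of_re_pos (by simpa using hs)))
  rw [Ne, Complex.cpow_eq_zero_iff]
  simp

/-- The Fourier coefficients of `θ ↦ |cos θ| ^ (iτ)`. -/
noncomputable def cosCoeff (τ : ℝ) (P : ℕ) : ℂ :=
  ∫ θ in (-π)..π, Complex.exp (P * θ * Complex.I) * absCPow τ (Real.cos θ)

theorem intervalIntegrable_of_bounded {f : ℝ → ℂ} (hf : Measurable f) {C : ℝ}
    (h : ∀ x, ‖f x‖ ≤ C) (a b : ℝ) : IntervalIntegrable f volume a b := by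
  refine (intervalIntegrable_const (c := C)).mono_fun hf.aestronglyMeasurable ?_
  filter_upwards with x
  exact (h x).trans (le_abs_self C)

/-- The function `|cos θ|^(iτ) cos θ e^(i(P+1)θ)` is periodic, so its derivative integrates to zero
over a period. Writing sine and cosine through exponentials, that derivative involves only the
frequencies `P` and `P + 2`. It may fail to exist at the zeros of the cosine, which are countably
many. -/
theorem cosCoeff_add_two (τ : ℝ) (P : ℕ) :
    (τ * Complex.I + P + 2) * cosCoeff τ (P + 2) = (τ * Complex.I - P) * cosCoeff τ P := by
  set E : ℕ → ℝ → ℂ := fun P θ => Complex.exp (P * θ * Complex.I) * absCPow τ (Real.cos θ) with hE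
  have hint : ∀ P, IntervalIntegrable (E P) volume (-π) π := by
    intro P
    refine intervalIntegrable_of_bounded (C := 1) ?_ ?_ _ _
    · have := measurable_absCPow τ
      fun_prop
    · intro x
      simp only [hE, norm_mul]
      rw [show (P * x * Complex.I : ℂ) = ((P * x : ℝ) : ℂ) * Complex.I by
        push_cast; rfl, Complex.norm_exp_ofReal_mul_I, one_mul]
      exact norm_absCPow_le _ _
  have key := MeasureTheory.integral_eq_of_hasDerivAt_off_countable
    (fun θ : ℝ => absCPow τ (Real.cos θ) * Real.cos θ * Complex.exp ((P + 1 : ℕ) * θ * Complex.I))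
    (fun θ => Complex.I / 2 * ((τ * Complex.I + P + 2) * E (P + 2) θ - (τ * Complex.I - P) * E P θ))
    (a := -π) (b := π) (s := {θ | Real.cos θ = 0}) ?_ ?_ ?_ ?_
  · rw [intervalIntegral.integral_const_mul, intervalIntegral.integral_sub
      ((hint _).const_mul _) ((hint _).const_mul _), intervalIntegral.integral_const_mul,
      intervalIntegral.integral_const_mul] at key
    have hz : (fun θ : ℝ => absCPow τ (Real.cos θ) * Real.cos θ *
        Complex.exp ((P + 1 : ℕ) * θ * Complex.I)) π - (fun θ : ℝ => absCPow τ (Real.cos θ) *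
        Real.cos θ * Complex.exp ((P + 1 : ℕ) * θ * Complex.I)) (-π) = 0 := by
      simp only [Real.cos_neg]
      rw [← mul_sub, Complex.ofReal_neg]
      have : Complex.exp ((P + 1 : ℕ) * (π : ℂ) * Complex.I) =
          Complex.exp ((P + 1 : ℕ) * (-π : ℂ) * Complex.I) := by
        rw [Complex.exp_eq_exp_iff_exists_int]
        exact ⟨(P + 1 : ℕ), by push_cast; ring⟩
      rw [this, sub_self, mul_zero]
    rw [hz] at key
    have h3 := (mul_eq_zero.mp key).resolve_left (by simp)
    exact sub_eq_zero.mp h3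
  · refine Set.Countable.mono (s₂ := Set.range fun k : ℤ => (2 * (k : ℝ) + 1) * π / 2) ?_
      (Set.countable_range _)
    intro θ hθ
    obtain ⟨k, hk⟩ := Real.cos_eq_zero_iff.mp hθ
    exact ⟨k, hk.symm⟩
  · have := continuous_absCPow_mul_self τ
    exact ((this.comp Real.continuous_cos).mul (by fun_prop)).continuousOn
  · rintro x ⟨-, hx⟩
    have h1 := (hasDerivAt_absCPow_mul_self τ (x := Real.cos x) hx).scomp x (Real.hasDerivAt_cos x)
    have h2 : HasDerivAt (fun θ : ℝ => Complex.exp ((P + 1 : ℕ) * θ * Complex.I))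
      (Complex.exp ((P + 1 : ℕ) * x * Complex.I) * ((P + 1 : ℕ) * (1 : ℝ) * Complex.I)) x :=
      (((hasDerivAt_id x).ofReal_comp.const_mul _).mul_const _).cexp
    refine (h1.mul h2).congr_deriv ?_
    simp only [hE, Function.comp, Complex.real_smul]
    have e2 : Complex.exp ((P + 2 : ℕ) * x * Complex.I) =
      Complex.exp ((P + 1 : ℕ) * x * Complex.I) * Complex.exp (x * Complex.I) := by
      rw [← Complex.exp_add]; push_cast; ring_nf
    have e0 : Complex.exp ((P : ℕ) * x * Complex.I) =
      Complex.exp ((P + 1 : ℕ) * x * Complex.I) * Complex.exp (-(x * Complex.I)) := by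
      rw [← Complex.exp_add]; push_cast; ring_nf
    rw [e2, e0, ← neg_mul, Complex.exp_mul_I x, Complex.exp_mul_I (-x), Complex.cos_neg,
      Complex.sin_neg]
    push_cast
    linear_combination (absCPow τ (Real.cos x) * Complex.exp ((P + 1 : ℂ) * x * Complex.I)) * (-1) *
      (τ * Complex.I + 1) * Complex.sin x * Complex.I_sq
  · exact (((hint _).const_mul _).sub ((hint _).const_mul _)).const_mul _

/-- For real `τ ≠ 0` the factor `iτ - P` of the recursion never vanishes, so nonvanishing propagates
upward from `P = 0`. Odd coefficients vanish under `θ ↦ θ + π`, hence the parity condition. -/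
theorem cosCoeff_ne_zero {τ : ℝ} (hτ : τ ≠ 0) (h0 : cosCoeff τ 0 ≠ 0) (P : ℕ) (hP : Even P) :
    cosCoeff τ P ≠ 0 := by
  obtain ⟨q, rfl⟩ := hP
  induction q with
  | zero => simpa using h0
  | succ q ih =>
    have h := cosCoeff_add_two τ (q + q)
    rw [show q + 1 + (q + 1) = q + q + 2 by ring]
    intro h4
    rw [h4, mul_zero, eq_comm] at h
    rcases mul_eq_zero.mp h with h | h
    · have := congrArg Complex.im h
      simp at this
      exact hτ this
    · exact ih h

/-! ### Gaussian integrals over the complex plane -/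

theorem stdGaussian_complex_eq_withDensity : stdGaussian ℂ =
    (volume : Measure ℂ).withDensity
      fun u => ENNReal.ofReal ((2 * π)⁻¹ * Real.exp (-‖u‖ ^ 2 / 2)) := by
  have hexp : ∀ w : ℂ, ∫ u : ℂ, Complex.exp (-(1 / 2 : ℂ) * ‖u‖ ^ 2 +
      Complex.I * (inner ℝ w u : ℝ)) = 2 * π * Complex.exp (-‖w‖ ^ 2 / 2) := by
    intro w
    rw [GaussianFourier.integral_cexp_neg_mul_sq_norm_add (by norm_num), Complex.finrank_real_complex]
    rw [show ((2 : ℕ) : ℂ) / 2 = 1 by norm_num, Complex.cpow_one, Complex.I_sq]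
    congr 1
    · field_simp
    · congr 1; ring
  have hint : ∀ w : ℂ, Integrable (fun u : ℂ => Complex.exp (-(1 / 2 : ℂ) * ‖u‖ ^ 2 +
      Complex.I * (inner ℝ w u : ℝ))) := by
    intro w
    exact GaussianFourier.integrable_cexp_neg_mul_sq_norm_add (by norm_num) _ _
  have hint' : Integrable fun u : ℂ => (2 * π)⁻¹ * Real.exp (-‖u‖ ^ 2 / 2) := by
    refine Integrable.const_mul ?_ _
    have h := (hint 0).re
    refine h.congr ?_
    filter_upwards with u
    simp only [inner_zero_left, Complex.ofReal_zero, mul_zero, add_zero]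
    rw [show (-(1 / 2 : ℂ) * ‖u‖ ^ 2) = ((-‖u‖ ^ 2 / 2 : ℝ) : ℂ) by push_cast; ring,
      ← Complex.ofReal_exp]
    rfl
  have : IsFiniteMeasure ((volume : Measure ℂ).withDensity
      fun u => ENNReal.ofReal ((2 * π)⁻¹ * Real.exp (-‖u‖ ^ 2 / 2))) :=
    isFiniteMeasure_withDensity_ofReal hint'.2
  refine Measure.ext_of_charFun ?_
  ext w
  rw [charFun_stdGaussian, charFun_apply, integral_withDensity_eq_integral_toReal_smul
    (by fun_prop) (by simp)]
  have : ∀ u : ℂ, (ENNReal.ofReal ((2 * π)⁻¹ * Real.exp (-‖u‖ ^ 2 / 2))).toReal •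
      Complex.exp ((inner ℝ u w : ℝ) * Complex.I) = (2 * π : ℂ)⁻¹ *
        Complex.exp (-(1 / 2 : ℂ) * ‖u‖ ^ 2 + Complex.I * (inner ℝ w u : ℝ)) := by
    intro u
    rw [ENNReal.toReal_ofReal (by positivity), Complex.exp_add, Complex.real_smul,
      real_inner_comm w u]
    push_cast
    rw [mul_assoc, mul_comm Complex.I]
    ring_nf
  simp_rw [this]
  rw [integral_const_mul, hexp, inv_mul_cancel_left₀ (by simp [Real.pi_ne_zero])]

theorem integral_stdGaussian_complex (F : ℂ → ℂ) :
    ∫ u, F u ∂(stdGaussian ℂ) = (2 * π : ℂ)⁻¹ * ∫ u : ℂ, Complex.exp (-‖u‖ ^ 2 / 2) * F u := by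
  rw [stdGaussian_complex_eq_withDensity, integral_withDensity_eq_integral_toReal_smul
    (by fun_prop) (by simp), ← integral_const_mul]
  congr 1 with u
  rw [ENNReal.toReal_ofReal (by positivity), Complex.real_smul]
  push_cast
  ring

/-- Polar coordinates separate the integrand. The Jacobian adds one power of `r`, which gives the
radial exponent `P + 1 + iτ`. -/
theorem integral_stdGaussian_pow_mul_absCPow (τ : ℝ) (P : ℕ) :
    ∫ u : ℂ, u ^ P * absCPow τ u.re ∂(stdGaussian ℂ) = (2 * π : ℂ)⁻¹ *
      ((∫ r in Set.Ioi (0 : ℝ), (r : ℂ) ^ ((P + 2 + τ * Complex.I : ℂ) - 1) *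
        Complex.exp (-(r : ℂ) ^ 2 / 2)) * cosCoeff τ P) := by
  rw [integral_stdGaussian_complex, ← Complex.integral_comp_polarCoord_symm, cosCoeff,
    polarCoord_target, intervalIntegral.integral_of_le (by linarith [Real.pi_pos]),
    integral_Ioc_eq_integral_Ioo, ← setIntegral_prod_mul]
  congr 1
  refine setIntegral_congr_fun (measurableSet_Ioi.prod measurableSet_Ioo) ?_
  rintro ⟨r, θ⟩ ⟨hr, -⟩
  have hr : 0 < r := hr
  have hr' : (r : ℂ) ≠ 0 := by exact_mod_cast hr.ne'
  simp only [Complex.polarCoord_symm_apply, Complex.real_smul]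
  have hre : ((r : ℂ) * (Real.cos θ + Real.sin θ * Complex.I)).re = r * Real.cos θ := by
    rw [Complex.re_ofReal_mul, Complex.add_re, Complex.re_ofReal_mul, Complex.ofReal_re]
    simp
  rw [hre, absCPow_mul, mul_pow, Complex.ofReal_cos, Complex.ofReal_sin, ← Complex.exp_mul_I,
    ← Complex.exp_nat_mul, norm_mul, Complex.norm_exp_ofReal_mul_I, Complex.norm_real, mul_one,
    Real.norm_of_nonneg hr.le, absCPow, abs_of_pos hr,
    show (P + 2 + τ * Complex.I - 1 : ℂ) = (P + 1 : ℕ) + τ * Complex.I by push_cast; ring,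
    Complex.cpow_add _ _ hr', Complex.cpow_natCast, pow_succ]
  ring_nf

/-- The real part of a complex Gaussian is a real standard Gaussian, so by evenness the integral is
twice a half-line integral of Gamma type. This is the base case for the angular recursion. -/
theorem integral_stdGaussian_absCPow_ne_zero (τ : ℝ) :
    ∫ u : ℂ, absCPow τ u.re ∂(stdGaussian ℂ) ≠ 0 := by
  have h1 : (stdGaussian ℂ).map Complex.reCLM = gaussianReal 0 1 := by
    rw [IsGaussian.map_eq_gaussianReal, integral_strongDual_stdGaussian,
      variance_dual_stdGaussian, Complex.reCLM_norm]
    simp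
  have h2 : ∫ u : ℂ, absCPow τ u.re ∂(stdGaussian ℂ) = ∫ x, absCPow τ x ∂(gaussianReal 0 1) := by
    rw [← h1, integral_map (by fun_prop) (measurable_absCPow τ).aestronglyMeasurable]
    rfl
  rw [h2, integral_gaussianReal_eq_integral_smul (by simp)]
  have h3 : ∀ x : ℝ, gaussianPDFReal 0 1 x • absCPow τ x =
      (fun y : ℝ => ((√(2 * π) : ℝ) : ℂ)⁻¹ * ((y : ℂ) ^ ((1 + τ * Complex.I : ℂ) - 1) *
        Complex.exp (-(y : ℂ) ^ 2 / 2))) |x| := by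
    intro x
    rw [gaussianPDFReal, absCPow, Complex.real_smul]
    simp only [← Complex.ofReal_pow, sq_abs]
    push_cast
    simp
    ring_nf
  have hi : Integrable fun x : ℝ => gaussianPDFReal 0 1 x • absCPow τ x := by
    refine (integrable_gaussianPDFReal 0 1).mono (by
      have := measurable_absCPow τ
      fun_prop) ?_
    filter_upwards with x
    rw [norm_smul]
    exact mul_le_of_le_one_right (norm_nonneg _) (norm_absCPow_le τ x)
  have h4 : ∫ x in Set.Iic (0 : ℝ), gaussianPDFReal 0 1 x • absCPow τ x =
      ∫ x in Set.Ioi (0 : ℝ), gaussianPDFReal 0 1 x • absCPow τ x := by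
    have := integral_comp_neg_Iic (0 : ℝ) fun x => gaussianPDFReal 0 1 x • absCPow τ x
    rw [neg_zero] at this
    rw [← this]
    simp_rw [h3, abs_neg]
  rw [← intervalIntegral.integral_Iic_add_Ioi hi.integrableOn hi.integrableOn (b := 0), h4,
    ← two_mul]
  have h5 : ∫ x in Set.Ioi (0 : ℝ), gaussianPDFReal 0 1 x • absCPow τ x =
      ((√(2 * π) : ℝ) : ℂ)⁻¹ * ∫ y in Set.Ioi (0 : ℝ), ((y : ℂ) ^ ((1 + τ * Complex.I : ℂ) - 1) *
        Complex.exp (-(y : ℂ) ^ 2 / 2)) := by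
    rw [← integral_const_mul]
    refine setIntegral_congr_fun measurableSet_Ioi fun x hx => ?_
    simp only [h3, abs_of_pos (Set.mem_Ioi.mp hx)]
  rw [h5]
  refine mul_ne_zero (by norm_num) (mul_ne_zero ?_
    (integral_cpow_mul_exp_neg_sq_ne_zero (by simp)))
  have : √(2 * π) ≠ 0 := by positivity
  simpa using this

theorem integral_stdGaussian_pow_mul_absCPow_ne_zero {τ : ℝ} (hτ : τ ≠ 0) {P : ℕ} (hP : Even P) :
    ∫ u : ℂ, u ^ P * absCPow τ u.re ∂(stdGaussian ℂ) ≠ 0 := by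
  -- The polar factorization is read backwards at `P = 0`: the product is nonzero, hence so is its
  -- angular factor.
  have h0 : cosCoeff τ 0 ≠ 0 := by
    have h1 := integral_stdGaussian_absCPow_ne_zero τ
    have h2 := integral_stdGaussian_pow_mul_absCPow τ 0
    simp only [pow_zero, one_mul] at h2
    rw [h2] at h1
    exact right_ne_zero_of_mul (right_ne_zero_of_mul h1)
  rw [integral_stdGaussian_pow_mul_absCPow]
  refine mul_ne_zero (by simp [Real.pi_ne_zero]) (mul_ne_zero
    (integral_cpow_mul_exp_neg_sq_ne_zero ?_) (cosCoeff_ne_zero hτ h0 P hP))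
  simp
  positivity

/-! ### Averaging over roots of unity and Gaussian vectors -/

theorem sum_eval_pow_of_isPrimitiveRoot {M : ℕ} {ζ : ℂ} (hζ : IsPrimitiveRoot ζ M)
    (p : Polynomial ℂ) (hp : p.natDegree < M) :
    ∑ l ∈ Finset.range M, p.eval (ζ ^ l) = M * p.coeff 0 := by
  simp_rw [Polynomial.eval_eq_sum_range' hp]
  rw [Finset.sum_comm]
  rw [Finset.sum_eq_single_of_mem 0 (Finset.mem_range.mpr (by omega))]
  · simp
  · intro i hi hi0
    rw [← Finset.mul_sum]
    have h1 : ζ ^ i ≠ 1 := hζ.pow_ne_one_of_pos_of_lt hi0 (Finset.mem_range.mp hi)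
    have h2 : ∑ l ∈ Finset.range M, (ζ ^ l) ^ i = ∑ l ∈ Finset.range M, (ζ ^ i) ^ l :=
      Finset.sum_congr rfl fun l _ => by rw [← pow_mul, ← pow_mul, mul_comm]
    rw [h2, geom_sum_eq h1, ← pow_mul, mul_comm i M, pow_mul, hζ.pow_eq_one]
    simp

section

variable {ι : Type*} [Fintype ι]

theorem sum_prod_add_root_mul_pow {M : ℕ} {ζ : ℂ} (hζ : IsPrimitiveRoot ζ M)
    (k : ι → ℕ) (hk : ∑ j, k j < M) (w : ℂ) (v : ι → ℂ) :
    ∑ l ∈ Finset.range M, ∏ j, (w + ζ ^ l * v j) ^ k j = M * w ^ ∑ j, k j := by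
  have h := sum_eval_pow_of_isPrimitiveRoot hζ
    (∏ j, (Polynomial.C w + Polynomial.X * Polynomial.C (v j)) ^ k j) ?_
  · simpa [mul_comm _ (v _), mul_comm (ζ ^ _), Polynomial.eval_prod, Polynomial.coeff_zero_prod, Polynomial.coeff_zero_eq_eval_zero,
      Finset.prod_pow_eq_pow_sum] using h
  · refine lt_of_le_of_lt (Polynomial.natDegree_prod_le _ _) (lt_of_le_of_lt ?_ hk)
    refine Finset.sum_le_sum fun j _ => Polynomial.natDegree_pow_le_of_le _ ?_ |>.trans_eq (mul_one _)
    compute_degree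

/-- The mean of the coordinates. -/
noncomputable def coordMean (z : EuclideanSpace ℂ ι) : ℂ := (Fintype.card ι : ℂ)⁻¹ * ∑ j, z j

theorem sum_sub_coordMean [Nonempty ι] (z : EuclideanSpace ℂ ι) :
    ∑ j, (z j - coordMean z) = 0 := by
  have : (Fintype.card ι : ℂ) ≠ 0 := by exact_mod_cast Fintype.card_ne_zero
  rw [Finset.sum_sub_distrib, coordMean]
  simp [this]

/-- The deviations from the mean sum to zero, so the cross terms cancel after summation. The total
is then the same for every unimodular multiplier, and the multiplier `1` gives back the original
vector. -/
theorem norm_sq_coordMean_add [Nonempty ι] {ζ : ℂ} (hζ : ‖ζ‖ = 1) (z : EuclideanSpace ℂ ι) :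
    ∑ j, ‖coordMean z + ζ * (z j - coordMean z)‖ ^ 2 = ∑ j, ‖z j‖ ^ 2 := by
  have key : ∀ ξ : ℂ, ‖ξ‖ = 1 → ∑ j, ‖coordMean z + ξ * (z j - coordMean z)‖ ^ 2 =
      ∑ j, (‖coordMean z‖ ^ 2 + ‖z j - coordMean z‖ ^ 2) := by
    intro ξ hξ
    have h1 : ∀ j, ‖coordMean z + ξ * (z j - coordMean z)‖ ^ 2 =
        (‖coordMean z‖ ^ 2 + ‖z j - coordMean z‖ ^ 2) +
          2 * (inner ℝ (coordMean z) (ξ * (z j - coordMean z))) := by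
      intro j
      rw [norm_add_sq_real, norm_mul, hξ]; ring
    simp_rw [h1]
    rw [Finset.sum_add_distrib, ← Finset.mul_sum, ← inner_sum, ← Finset.mul_sum,
      sum_sub_coordMean]
    simp
  rw [key ζ hζ, ← key 1 (by simp)]
  simp

/-- The unitary map which fixes the mean of the coordinates and multiplies the deviations from the
mean by a complex number of modulus one. -/
noncomputable def deviationRotation [Nonempty ι] {ζ : ℂ} (hζ : ‖ζ‖ = 1) :
    EuclideanSpace ℂ ι ≃ₗᵢ[ℝ] EuclideanSpace ℂ ι :=
  LinearIsometry.toLinearIsometryEquiv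
    { toFun := fun z => WithLp.toLp 2 fun j => coordMean z + ζ * (z j - coordMean z)
      map_add' := fun x y => by
        ext j
        simp only [coordMean, PiLp.add_apply, Finset.sum_add_distrib]
        ring
      map_smul' := fun c x => by
        ext j
        simp only [coordMean, PiLp.smul_apply, Complex.real_smul, RingHom.id_apply, ← Finset.mul_sum]
        ring
      norm_map' := fun z => by
        simp only [LinearMap.coe_mk, AddHom.coe_mk, EuclideanSpace.norm_eq]
        rw [norm_sq_coordMean_add hζ] } rfl

theorem deviationRotation_apply [Nonempty ι] {ζ : ℂ} (hζ : ‖ζ‖ = 1) (z : EuclideanSpace ℂ ι)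
    (j : ι) : deviationRotation hζ z j = coordMean z + ζ * (z j - coordMean z) := rfl

theorem coordMean_deviationRotation [Nonempty ι] {ζ : ℂ} (hζ : ‖ζ‖ = 1)
    (z : EuclideanSpace ℂ ι) : coordMean (deviationRotation hζ z) = coordMean z := by
  have : (Fintype.card ι : ℂ) ≠ 0 := by exact_mod_cast Fintype.card_ne_zero
  rw [coordMean]
  simp_rw [deviationRotation_apply]
  rw [Finset.sum_add_distrib, ← Finset.mul_sum, sum_sub_coordMean]
  simp [this]

/-- Multiplication of the coordinates by complex numbers of modulus one. -/
noncomputable def coordRotation (ξ : ι → ℂ) (hξ : ∀ j, ‖ξ j‖ = 1) :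
    EuclideanSpace ℂ ι ≃ₗᵢ[ℝ] EuclideanSpace ℂ ι :=
  LinearIsometry.toLinearIsometryEquiv
    { toFun := fun z => WithLp.toLp 2 fun j => ξ j * z j
      map_add' := fun x y => by
        ext j
        simp only [PiLp.add_apply]
        ring
      map_smul' := fun c x => by
        ext j
        simp only [PiLp.smul_apply, Complex.real_smul, RingHom.id_apply]
        ring
      norm_map' := fun z => by
        simp only [LinearMap.coe_mk, AddHom.coe_mk, EuclideanSpace.norm_eq, norm_mul, hξ, one_mul] }
    rfl

theorem coordRotation_apply (ξ : ι → ℂ) (hξ : ∀ j, ‖ξ j‖ = 1) (z : EuclideanSpace ℂ ι)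
    (j : ι) : coordRotation ξ hξ z j = ξ j * z j := rfl

theorem integral_stdGaussian_comp_isometry {E : Type*} [NormedAddCommGroup E]
    [InnerProductSpace ℝ E] [FiniteDimensional ℝ E] [MeasurableSpace E] [BorelSpace E]
    (U : E ≃ₗᵢ[ℝ] E) (F : E → ℂ) :
    ∫ z, F (U z) ∂(stdGaussian E) = ∫ z, F z ∂(stdGaussian E) := by
  conv_rhs => rw [← stdGaussian_map U]
  exact (integral_map_equiv U.toHomeomorph.toMeasurableEquiv F).symm

theorem integrable_prod_coord_pow (k : ι → ℕ) :
    Integrable (fun z : EuclideanSpace ℂ ι => ∏ j, z j ^ k j) (stdGaussian (EuclideanSpace ℂ ι)) := by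
  have h : Integrable (fun z : EuclideanSpace ℂ ι => ‖z‖ ^ ∑ j, k j)
      (stdGaussian (EuclideanSpace ℂ ι)) := by
    have := IsGaussian.memLp_id (stdGaussian (EuclideanSpace ℂ ι)) ((∑ j, k j : ℕ) : ENNReal)
      (by simp)
    exact this.integrable_norm_pow'
  refine h.mono' (by fun_prop) ?_
  filter_upwards with z
  rw [norm_prod, ← Finset.prod_pow_eq_pow_sum]
  refine Finset.prod_le_prod (fun _ _ => norm_nonneg _) fun j _ => ?_
  rw [norm_pow]
  exact pow_le_pow_left₀ (norm_nonneg _) (PiLp.norm_apply_le z j) _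

/-- The normalized sum of the coordinates. -/
noncomputable def normalizedSum : EuclideanSpace ℂ ι →L[ℝ] ℂ :=
  LinearMap.toContinuousLinearMap
    { toFun := fun z => ((√(Fintype.card ι))⁻¹ : ℝ) • ∑ j, z j
      map_add' := fun x y => by simp [Finset.sum_add_distrib]
      map_smul' := fun c x => by
        simp only [PiLp.smul_apply, ← Finset.smul_sum, RingHom.id_apply]
        rw [smul_comm] }

theorem normalizedSum_apply (z : EuclideanSpace ℂ ι) :
    normalizedSum z = ((√(Fintype.card ι))⁻¹ : ℝ) • ∑ j, z j := rfl

theorem stdGaussian_map_normalizedSum [Nonempty ι] :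
    (stdGaussian (EuclideanSpace ℂ ι)).map normalizedSum = stdGaussian ℂ := by
  have hn : (0 : ℝ) < Fintype.card ι := by exact_mod_cast Fintype.card_pos
  refine Measure.ext_of_charFun ?_
  ext t
  rw [charFun_stdGaussian, charFun_apply, integral_map (by fun_prop) (by fun_prop)]
  have h1 : ∀ z : EuclideanSpace ℂ ι, inner ℝ (normalizedSum z) t =
      inner ℝ z (WithLp.toLp 2 fun _ : ι => ((√(Fintype.card ι))⁻¹ : ℝ) • t) := by
    intro z
    rw [normalizedSum_apply, PiLp.inner_apply, real_inner_smul_left, sum_inner, Finset.mul_sum]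
    simp only [real_inner_smul_right]
  simp_rw [h1]
  rw [← charFun_apply, charFun_stdGaussian]
  congr 3
  norm_cast
  rw [EuclideanSpace.norm_sq_eq]
  simp [mul_pow]

/-- Multiplying the deviations by a root of unity preserves both the Gaussian measure and the sum of
the coordinates. Averaging the monomial over these rotations leaves only the power `P` of the mean,
so the integrand becomes a function of the normalized sum alone, which is again a standard complex
Gaussian. -/
theorem integral_prod_coord_pow_mul_absCPow_ne_zero [Nonempty ι] {τ : ℝ} (hτ : τ ≠ 0)
    (k : ι → ℕ) (hk : Even (∑ j, k j)) :
    ∫ z : EuclideanSpace ℂ ι, (∏ j, z j ^ k j) * absCPow τ (∑ j, z j).re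
      ∂(stdGaussian (EuclideanSpace ℂ ι)) ≠ 0 := by
  set μ := stdGaussian (EuclideanSpace ℂ ι)
  set P := ∑ j, k j with hP
  have hn : (0 : ℝ) < Fintype.card ι := by exact_mod_cast Fintype.card_pos
  have hn' : (Fintype.card ι : ℂ) ≠ 0 := by exact_mod_cast hn.ne'
  have hsum : ∀ z : EuclideanSpace ℂ ι, ∑ j, z j = Fintype.card ι * coordMean z := fun z => by
    rw [coordMean, mul_inv_cancel_left₀ hn']
  -- The order `P + 1` exceeds the degree `P` in the root variable, so only the constant term
  -- survives the averaging.
  obtain ⟨ζ, hζ⟩ : ∃ ζ : ℂ, IsPrimitiveRoot ζ (P + 1) :=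
    ⟨_, Complex.isPrimitiveRoot_exp (P + 1) (by omega)⟩
  have hζn : ∀ l, ‖ζ ^ l‖ = 1 := fun l => by
    rw [norm_pow, hζ.norm'_eq_one (by omega), one_pow]
  have hint : ∀ l, Integrable (fun z : EuclideanSpace ℂ ι =>
      (∏ j, (deviationRotation (hζn l) z) j ^ k j) * absCPow τ (∑ j, z j).re) μ := by
    intro l
    have h1 : Integrable (fun z : EuclideanSpace ℂ ι =>
      (∏ j, (deviationRotation (hζn l) z) j ^ k j)) μ := by
      have := integrable_prod_coord_pow k
      rw [← stdGaussian_map (deviationRotation (hζn l))] at this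
      exact this.comp_measurable (deviationRotation (hζn l)).continuous.measurable
    exact h1.mul_bdd (c := 1)
      ((measurable_absCPow τ).comp (by fun_prop)).aestronglyMeasurable (ae_of_all _ fun z => norm_absCPow_le _ _)
  have havg : ((P + 1 : ℕ) : ℂ) * ∫ z : EuclideanSpace ℂ ι, (∏ j, z j ^ k j) *
      absCPow τ (∑ j, z j).re ∂μ = ((P + 1 : ℕ) : ℂ) *
        ∫ z : EuclideanSpace ℂ ι, coordMean z ^ P * absCPow τ (∑ j, z j).re ∂μ := by
    rw [← integral_const_mul]
    calc _ = ∑ l ∈ Finset.range (P + 1), ∫ z : EuclideanSpace ℂ ι, (∏ j, z j ^ k j) *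
        absCPow τ (∑ j, z j).re ∂μ := by
          rw [integral_const_mul, Finset.sum_const, Finset.card_range, nsmul_eq_mul]
      _ = ∑ l ∈ Finset.range (P + 1), ∫ z : EuclideanSpace ℂ ι,
        (∏ j, (deviationRotation (hζn l) z) j ^ k j) * absCPow τ (∑ j, z j).re ∂μ := by
          refine Finset.sum_congr rfl fun l _ => ?_
          rw [← integral_stdGaussian_comp_isometry (deviationRotation (hζn l))]
          simp_rw [hsum, coordMean_deviationRotation]
          rfl
      _ = _ := by
          rw [← integral_finsetSum _ fun l _ => hint l]
          rw [← integral_const_mul]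
          congr 1 with z
          rw [← Finset.sum_mul, ← mul_assoc,
            ← sum_prod_add_root_mul_pow hζ k (by omega) (coordMean z) fun j => z j - coordMean z]
          rfl
  have h2 := mul_left_cancel₀ (by exact_mod_cast (Nat.succ_ne_zero P)) havg
  rw [h2]
  have hs0 : √(Fintype.card ι : ℝ) ≠ 0 := by positivity
  -- Mean and sum are the normalized sum divided and multiplied by the square root of the dimension.
  -- Both factors are multiplicative, so the scaling comes out as a nonzero constant.
  have h3 : ∀ z : EuclideanSpace ℂ ι, coordMean z ^ P * absCPow τ (∑ j, z j).re =
      ((((√(Fintype.card ι : ℝ) : ℝ) : ℂ)⁻¹) ^ P * absCPow τ (√(Fintype.card ι : ℝ))) *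
        (fun u : ℂ => u ^ P * absCPow τ u.re) (normalizedSum z) := by
    intro z
    have e1 : ∑ j, z j = √(Fintype.card ι : ℝ) * normalizedSum z := by
      rw [normalizedSum_apply, Complex.real_smul, ← mul_assoc, ← Complex.ofReal_mul,
        mul_inv_cancel₀ hs0]
      simp
    have e2 : coordMean z = ((√(Fintype.card ι : ℝ) : ℝ) : ℂ)⁻¹ * normalizedSum z := by
      rw [coordMean, e1, ← mul_assoc]
      congr 1
      rw [inv_mul_eq_iff_eq_mul₀ hn', eq_mul_inv_iff_mul_eq₀ (by exact_mod_cast hs0)]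
      norm_cast
      rw [Real.mul_self_sqrt hn.le]
    rw [e1, Complex.re_ofReal_mul, absCPow_mul, e2, mul_pow]
    ring
  simp_rw [h3]
  have h4 : ∫ z, (fun u : ℂ => u ^ P * absCPow τ u.re) (normalizedSum z) ∂μ =
      ∫ u : ℂ, u ^ P * absCPow τ u.re ∂(stdGaussian ℂ) := by
    rw [← stdGaussian_map_normalizedSum (ι := ι), integral_map (by fun_prop)]
    have := measurable_absCPow τ
    exact Measurable.aestronglyMeasurable (by fun_prop)
  rw [integral_const_mul, h4]
  refine mul_ne_zero (mul_ne_zero (pow_ne_zero _ (inv_ne_zero (by exact_mod_cast hs0))) ?_)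
    (integral_stdGaussian_pow_mul_absCPow_ne_zero hτ hk)
  rw [absCPow_of_ne_zero _ hs0]
  exact Complex.exp_ne_zero _

end

/-! ### Weyl's criterion in continuous time -/

theorem hasDerivAt_exp_two_pi_int (h : ℤ) (s : ℝ) :
    HasDerivAt (fun s : ℝ => Complex.exp (2 * π * Complex.I * h * s))
      (2 * π * Complex.I * h * Complex.exp (2 * π * Complex.I * h * s)) s := by
  have := (((hasDerivAt_id s).ofReal_comp).const_mul (2 * π * Complex.I * h : ℂ)).cexp
  refine this.congr_deriv ?_
  simp
  ring

theorem exp_two_pi_int_fract (h : ℤ) (x : ℝ) :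
    Complex.exp (2 * π * Complex.I * h * (Int.fract x : ℝ)) =
      Complex.exp (2 * π * Complex.I * h * x) := by
  rw [Complex.exp_eq_exp_iff_exists_int]
  refine ⟨-(h * ⌊x⌋), ?_⟩
  rw [Int.fract]
  push_cast
  ring

theorem norm_exp_two_pi_int (h : ℤ) (x : ℝ) :
    ‖Complex.exp (2 * π * Complex.I * h * x)‖ = 1 := by
  rw [show (2 * π * Complex.I * h * x : ℂ) = ((2 * π * h * x : ℝ) : ℂ) * Complex.I by
    push_cast; ring, Complex.norm_exp_ofReal_mul_I]

theorem integral_exp_two_pi_int_mul_self {h : ℤ} (hh : h ≠ 0) :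
    ∫ s in (0 : ℝ)..1, 2 * π * Complex.I * h * Complex.exp (2 * π * Complex.I * h * s) * s = 1 := by
  have hc : (2 * π * Complex.I * h : ℂ) ≠ 0 := by simp [Real.pi_ne_zero, hh]
  have hd : ∀ s : ℝ, HasDerivAt (fun s : ℝ => Complex.exp (2 * π * Complex.I * h * s) * s -
      (2 * π * Complex.I * h)⁻¹ * Complex.exp (2 * π * Complex.I * h * s))
      (2 * π * Complex.I * h * Complex.exp (2 * π * Complex.I * h * s) * s) s := by
    intro s
    refine (((hasDerivAt_exp_two_pi_int h s).mul (hasDerivAt_id s).ofReal_comp).sub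
      ((hasDerivAt_exp_two_pi_int h s).const_mul _)).congr_deriv ?_
    simp only [Complex.ofReal_one, mul_one, id]
    field_simp
    ring
  rw [intervalIntegral.integral_eq_sub_of_hasDerivAt (fun s _ => hd s)
    (Continuous.intervalIntegrable (by fun_prop) _ _)]
  have : Complex.exp (2 * π * Complex.I * h * (1 : ℝ)) = 1 := by
    rw [Complex.exp_eq_one_iff]; exact ⟨h, by push_cast; ring⟩
  rw [this]
  simp

/-- The fundamental theorem of calculus on `[x, 1]`, together with the value `1` of the character at
`1`. The point `x` now enters only through the events `x ≤ s`, whose densities are what the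
hypothesis of uniform distribution controls. -/
theorem exp_two_pi_int_eq_one_sub_integral (h : ℤ) {x : ℝ} (h0 : 0 ≤ x) (h1 : x ≤ 1) :
    Complex.exp (2 * π * Complex.I * h * x) = 1 - ∫ s in (0 : ℝ)..1,
      2 * π * Complex.I * h * Complex.exp (2 * π * Complex.I * h * s) *
        (Set.Ici x).indicator 1 s := by
  have e1 : ∀ s : ℝ, 2 * π * Complex.I * h * Complex.exp (2 * π * Complex.I * h * s) *
        (Set.Ici x).indicator 1 s = (Set.Ici x).indicator
          (fun s : ℝ => 2 * π * Complex.I * h * Complex.exp (2 * π * Complex.I * h * s)) s := by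
    intro s
    by_cases hs : s ∈ Set.Ici x <;> simp [hs]
  simp_rw [e1]
  rw [intervalIntegral.integral_of_le zero_le_one, ← integral_Icc_eq_integral_Ioc,
    setIntegral_indicator measurableSet_Ici]
  have e2 : Set.Icc 0 1 ∩ Set.Ici x = Set.Icc x 1 := by
    ext s; simp only [Set.mem_inter_iff, Set.mem_Icc, Set.mem_Ici]
    constructor
    · rintro ⟨⟨_, b⟩, c⟩; exact ⟨c, b⟩
    · rintro ⟨a, b⟩; exact ⟨⟨h0.trans a, b⟩, a⟩
  rw [e2, integral_Icc_eq_integral_Ioc, ← intervalIntegral.integral_of_le h1,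
    intervalIntegral.integral_eq_sub_of_hasDerivAt (fun s _ => hasDerivAt_exp_two_pi_int h s)
    (Continuous.intervalIntegrable (by fun_prop) _ _)]
  have : Complex.exp (2 * π * Complex.I * h * (1 : ℝ)) = 1 := by
    rw [Complex.exp_eq_one_iff]; exact ⟨h, by push_cast; ring⟩
  rw [this]
  ring

/-- Weyl's criterion in continuous time: uniform distribution modulo one implies that the averages
of the nontrivial characters tend to zero. -/
theorem tendsto_average_exp_of_tendsto_density {v : ℝ → ℝ} (hv : Measurable v)
    (hd : ∀ s ∈ Set.Ico (0 : ℝ) 1, Tendsto (fun T : ℝ =>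
      volume.real {t : ℝ | t ∈ Set.Icc 0 T ∧ Int.fract (v t) ≤ s} / T) atTop (𝓝 s))
    {h : ℤ} (hh : h ≠ 0) :
    Tendsto (fun T : ℝ => (T : ℂ)⁻¹ * ∫ t in (0 : ℝ)..T, Complex.exp (2 * π * Complex.I * h * v t))
      atTop (𝓝 0) := by
  set c : ℝ → ℂ := fun s => 2 * π * Complex.I * h * Complex.exp (2 * π * Complex.I * h * s) with hc
  have hcc : Continuous c := by fun_prop
  have hcn : ∀ s, ‖c s‖ = ‖(2 * π * Complex.I * h : ℂ)‖ := fun s => by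
    simp only [hc]; rw [norm_mul, norm_exp_two_pi_int, mul_one]
  have hmeas : ∀ s, MeasurableSet {t | Int.fract (v t) ≤ s} := fun s =>
    measurableSet_le hv.fract measurable_const
  -- Fubini after inserting the indicator representation: the average of the character becomes an
  -- integral against the empirical distribution function.
  have key : ∀ T : ℝ, 0 < T → (T : ℂ)⁻¹ * ∫ t in (0 : ℝ)..T,
      Complex.exp (2 * π * Complex.I * h * v t) = 1 - ∫ s in (0 : ℝ)..1, c s *
        ((volume.real {t : ℝ | t ∈ Set.Icc 0 T ∧ Int.fract (v t) ≤ s} / T : ℝ) : ℂ) := by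
    intro T hT
    have hT' : (T : ℂ) ≠ 0 := by exact_mod_cast hT.ne'
    set k : ℝ → ℝ → ℂ := fun t s => c s * (Set.Ici (Int.fract (v t))).indicator 1 s with hk
    have hkint : Integrable (Function.uncurry k) ((volume.restrict (Set.uIoc 0 T)).prod
        (volume.restrict (Set.uIoc 0 1))) := by
      have : IsFiniteMeasure (volume.restrict (Set.uIoc 0 T)) := by
        rw [Set.uIoc_of_le hT.le]; infer_instance
      have : IsFiniteMeasure (volume.restrict (Set.uIoc (0 : ℝ) 1)) := by
        rw [Set.uIoc_of_le zero_le_one]; infer_instance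
      have e : Function.uncurry k = {p : ℝ × ℝ | Int.fract (v p.1) ≤ p.2}.indicator
          (fun p => c p.2) := by
        ext ⟨t, s⟩
        simp only [hk, Function.uncurry_apply_pair, Set.indicator_apply, Set.mem_Ici,
          Set.mem_ofPred_eq]
        split_ifs <;> simp
      rw [e]
      refine Integrable.indicator ?_ (measurableSet_le (hv.fract.comp measurable_fst) measurable_snd)
      refine Integrable.of_bound (C := ‖(2 * π * Complex.I * h : ℂ)‖)
        (by fun_prop) (ae_of_all _ fun p => (hcn _).le)
    have e1 : ∀ t, Complex.exp (2 * π * Complex.I * h * v t) = 1 - ∫ s in (0 : ℝ)..1, k t s := by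
      intro t
      rw [← exp_two_pi_int_fract]
      exact exp_two_pi_int_eq_one_sub_integral h (Int.fract_nonneg _) (Int.fract_lt_one _).le
    have hi2 : IntervalIntegrable (fun t => ∫ s in (0 : ℝ)..1, k t s) volume 0 T := by
      have := hkint.integral_prod_left
      rw [intervalIntegrable_iff]
      simp_rw [intervalIntegral.integral_of_le (zero_le_one' ℝ)]
      rw [Set.uIoc_of_le (zero_le_one' ℝ)] at this
      exact this
    have e2 : ∫ t in (0 : ℝ)..T, ∫ s in (0 : ℝ)..1, k t s =
        ∫ s in (0 : ℝ)..1, ∫ t in (0 : ℝ)..T, k t s := by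
      simp_rw [intervalIntegral.integral_of_le (zero_le_one' ℝ), intervalIntegral.integral_of_le hT.le]
      rw [Set.uIoc_of_le (zero_le_one' ℝ), Set.uIoc_of_le hT.le] at hkint
      exact integral_integral_swap hkint
    have e3 : ∀ s, ∫ t in (0 : ℝ)..T, k t s =
        c s * (volume.real {t : ℝ | t ∈ Set.Icc 0 T ∧ Int.fract (v t) ≤ s} : ℂ) := by
      intro s
      simp only [hk]
      rw [intervalIntegral.integral_const_mul, intervalIntegral.integral_of_le hT.le,
        ← integral_Icc_eq_integral_Ioc]
      congr 1
      have : ∀ t, (Set.Ici (Int.fract (v t))).indicator (1 : ℝ → ℂ) s =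
          {t | Int.fract (v t) ≤ s}.indicator (1 : ℝ → ℂ) t := by
        intro t
        simp [Set.indicator_apply]
      simp_rw [this]
      rw [setIntegral_indicator (hmeas s)]
      simp only [Pi.one_apply, integral_const]
      rw [measureReal_restrict_apply_univ]
      simp
      rfl
    simp_rw [e1]
    rw [intervalIntegral.integral_sub (by simp) hi2, e2]
    simp_rw [e3]
    rw [mul_sub]
    congr 1
    · simp [hT']
    · rw [← intervalIntegral.integral_const_mul]
      refine intervalIntegral.integral_congr fun s _ => ?_
      push_cast
      field_simp
  have hlim : Tendsto (fun T : ℝ => ∫ s in (0 : ℝ)..1, c s *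
        ((volume.real {t : ℝ | t ∈ Set.Icc 0 T ∧ Int.fract (v t) ≤ s} / T : ℝ) : ℂ)) atTop
      (𝓝 (∫ s in (0 : ℝ)..1, c s * s)) := by
    refine intervalIntegral.tendsto_integral_filter_of_dominated_convergence
      (fun _ => ‖(2 * π * Complex.I * h : ℂ)‖) ?_ ?_ (by simp) ?_
    · filter_upwards with T
      refine Measurable.aestronglyMeasurable (hcc.measurable.mul
        (Complex.measurable_ofReal.comp (Measurable.div_const (Monotone.measurable ?_) T)))
      intro s s' hs
      refine measureReal_mono (fun t ht => ⟨ht.1, ht.2.trans hs⟩) ?_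
      exact ne_top_of_le_ne_top (by simp) (measure_mono (t := Set.Icc 0 T) fun t ht => ht.1)
    · filter_upwards [eventually_gt_atTop 0] with T hT
      filter_upwards with s _
      rw [norm_mul, hcn, Complex.norm_real, Real.norm_of_nonneg (by positivity)]
      refine mul_le_of_le_one_right (norm_nonneg _) ((div_le_one hT).mpr ?_)
      calc _ ≤ volume.real (Set.Icc 0 T) := measureReal_mono (fun t ht => ht.1) (by simp)
        _ = T := by simp [hT.le]
    -- The hypothesis covers only `s < 1`; the excluded endpoint is a null set.
    · have : ∀ᵐ s : ℝ, s ≠ 1 := by simp [ae_iff]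
      filter_upwards [this] with s hs1 hs
      rw [Set.uIoc_of_le zero_le_one] at hs
      exact ((Complex.continuous_ofReal.tendsto _).comp
        (hd s ⟨hs.1.le, lt_of_le_of_ne hs.2 hs1⟩)).const_mul _
  rw [integral_exp_two_pi_int_mul_self hh] at hlim
  have := hlim.const_sub 1
  rw [sub_self] at this
  refine this.congr' ?_
  filter_upwards [eventually_gt_atTop 0] with T hT
  exact (key T hT).symm

theorem unitAddCircle_coe_eq_iff {x y : ℝ} :
    (x : UnitAddCircle) = (y : UnitAddCircle) ↔ ∃ n : ℤ, x = y + n := by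
  rw [← sub_eq_zero, ← AddCircle.coe_sub, AddCircle.coe_eq_zero_iff]
  simp only [zsmul_eq_mul, mul_one]
  exact exists_congr fun n => ⟨fun h => by linarith, fun h => by linarith⟩

theorem volume_singleton_unitAddCircle (y : UnitAddCircle) : volume {y} = 0 := by
  obtain ⟨x, rfl⟩ := QuotientAddGroup.mk_surjective y
  rw [← (UnitAddCircle.measurePreserving_mk 0).measure_preimage
    (measurableSet_singleton _).nullMeasurableSet]
  refine measure_mono_null ?_ ((Set.countable_range fun n : ℤ => x + n).measure_zero _)
  intro z hz
  obtain ⟨n, hn⟩ := unitAddCircle_coe_eq_iff.mp hz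
  exact ⟨n, hn.symm⟩

theorem preimage_image_fract_le (s : ℝ) :
    ((↑) : ℝ → UnitAddCircle) ⁻¹' (((↑) : ℝ → UnitAddCircle) '' {x : ℝ | Int.fract x ≤ s}) =
      {x : ℝ | Int.fract x ≤ s} := by
  refine Set.Subset.antisymm ?_ (Set.subset_preimage_image _ _)
  rintro x ⟨y, hy, hxy⟩
  obtain ⟨n, hn⟩ := unitAddCircle_coe_eq_iff.mp hxy
  rw [Set.mem_ofPred_eq, hn, Int.fract_add_intCast] at hy
  exact hy

theorem image_fract_le {s : ℝ} (h1 : s < 1) : ((↑) : ℝ → UnitAddCircle) '' {x : ℝ | Int.fract x ≤ s} =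
    ((↑) : ℝ → UnitAddCircle) '' Set.Icc 0 s := by
  ext y
  constructor
  · rintro ⟨x, hx, rfl⟩
    refine ⟨Int.fract x, ⟨Int.fract_nonneg x, hx⟩, unitAddCircle_coe_eq_iff.mpr ⟨-⌊x⌋, ?_⟩⟩
    rw [Int.fract]
    push_cast
    ring
  · rintro ⟨x, hx, rfl⟩
    refine ⟨x, ?_, rfl⟩
    rw [Set.mem_ofPred_eq, Int.fract_eq_self.mpr ⟨hx.1, hx.2.trans_lt h1⟩]
    exact hx.2

theorem isClosed_image_fract_le {s : ℝ} (h1 : s < 1) :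
    IsClosed (((↑) : ℝ → UnitAddCircle) '' {x : ℝ | Int.fract x ≤ s}) := by
  rw [image_fract_le h1]
  exact (isCompact_Icc.image (AddCircle.continuous_mk' 1)).isClosed

/-- The image of the arc has at most two boundary points, those of `0` and `s`. It is therefore a
continuity set, as passing from weak convergence to convergence of measures of sets requires. -/
theorem volume_image_fract_le {s : ℝ} (h0 : 0 ≤ s) (h1 : s < 1) :
    volume (((↑) : ℝ → UnitAddCircle) '' {x : ℝ | Int.fract x ≤ s}) = ENNReal.ofReal s ∧
    volume (frontier (((↑) : ℝ → UnitAddCircle) '' {x : ℝ | Int.fract x ≤ s})) = 0 := by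
  have hclosed := isClosed_image_fract_le h1
  have hmp := UnitAddCircle.measurePreserving_mk 0
  constructor
  · rw [← hmp.measure_preimage hclosed.measurableSet.nullMeasurableSet, preimage_image_fract_le,
      Measure.restrict_apply (measurableSet_le measurable_fract measurable_const)]
    have : volume ({x : ℝ | Int.fract x ≤ s} ∩ Set.Ioc 0 (0 + 1)) = volume (Set.Ioc 0 s) := by
      refine measure_congr ?_
      have h : ∀ᵐ x : ℝ, x ≠ 1 := by simp [ae_iff]
      filter_upwards [h] with x hx
      simp only [eq_iff_iff]
      change (Int.fract x ≤ s ∧ 0 < x ∧ x ≤ 0 + 1) ↔ (0 < x ∧ x ≤ s)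
      rw [zero_add]
      constructor
      · rintro ⟨a, b, c⟩
        rw [Int.fract_eq_self.mpr ⟨b.le, lt_of_le_of_ne c hx⟩] at a
        exact ⟨b, a⟩
      · rintro ⟨a, b⟩
        rw [Int.fract_eq_self.mpr ⟨a.le, b.trans_lt h1⟩]
        exact ⟨b, a, b.trans h1.le⟩
    rw [this]
    simp
  · refine measure_mono_null (t := {((0 : ℝ) : UnitAddCircle), ((s : ℝ) : UnitAddCircle)}) ?_ ?_
    · rw [hclosed.frontier_eq, image_fract_le h1]
      rintro _ ⟨⟨x, hx, rfl⟩, hy⟩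
      by_contra hne
      simp only [Set.mem_insert_iff, Set.mem_singleton_iff, not_or] at hne
      refine hy (mem_interior.mpr ⟨((↑) : ℝ → UnitAddCircle) '' Set.Ioo 0 s,
        Set.image_mono Set.Ioo_subset_Icc_self, QuotientAddGroup.isOpenMap_coe _ isOpen_Ioo,
        x, ⟨lt_of_le_of_ne hx.1 ?_, lt_of_le_of_ne hx.2 ?_⟩, rfl⟩)
      · rintro rfl; exact hne.1 rfl
      · rintro rfl; exact hne.2 rfl
    · exact measure_union_null (volume_singleton_unitAddCircle _) (volume_singleton_unitAddCircle _)

/-- Weyl's criterion in continuous time: if the averages of the nontrivial characters tend to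
zero, then the function is uniformly distributed modulo one. -/
theorem tendsto_density_of_tendsto_average_exp {v : ℝ → ℝ} (hv : Measurable v)
    (hd : ∀ h : ℤ, h ≠ 0 → Tendsto (fun T : ℝ => (T : ℂ)⁻¹ * ∫ t in (0 : ℝ)..T,
      Complex.exp (2 * π * Complex.I * h * v t)) atTop (𝓝 0))
    {s : ℝ} (hs : s ∈ Set.Ico (0 : ℝ) 1) :
    Tendsto (fun T : ℝ => volume.real {t : ℝ | t ∈ Set.Icc 0 T ∧ Int.fract (v t) ≤ s} / T)
      atTop (𝓝 s) := by
  have hvm : Measurable fun t : ℝ => (v t : UnitAddCircle) := AddCircle.measurable_mk'.comp hv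
  have hprob : IsProbabilityMeasure (volume : Measure UnitAddCircle) :=
    ⟨by simp⟩
  set μ₀ : ProbabilityMeasure UnitAddCircle := ⟨volume, hprob⟩ with hμ₀
  -- Using `max T 1` makes this a probability measure for every real `T`; it is the empirical
  -- measure on `[0, T]` once `T ≥ 1`.
  set m : ℝ → Measure UnitAddCircle := fun T => (ENNReal.ofReal (max T 1))⁻¹ •
    (volume.restrict (Set.Icc 0 (max T 1))).map (fun t : ℝ => (v t : UnitAddCircle)) with hm
  have hmp : ∀ T, IsProbabilityMeasure (m T) := by
    intro T
    have h0 : (0 : ℝ) < max T 1 := by positivity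
    refine ⟨?_⟩
    rw [hm, Measure.smul_apply, Measure.map_apply hvm .univ]
    simp [ENNReal.inv_mul_cancel]
  set μ : ℝ → ProbabilityMeasure UnitAddCircle := fun T => ⟨m T, hmp T⟩ with hμ
  have hint : ∀ g : C(UnitAddCircle, ℂ), ∀ T : ℝ, 1 ≤ T → ∫ x, g x ∂(m T) =
      (T : ℂ)⁻¹ * ∫ t in (0 : ℝ)..T, g (v t) := by
    intro g T hT
    simp only [hm, max_eq_left hT]
    rw [integral_smul_measure, integral_map hvm.aemeasurable g.continuous.aestronglyMeasurable,
      integral_Icc_eq_integral_Ioc, ← intervalIntegral.integral_of_le (by linarith),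
      ENNReal.toReal_inv, ENNReal.toReal_ofReal (by linarith), Complex.real_smul]
    push_cast
    rfl
  have hg : ∀ g ∈ (fourierSubalgebra : StarSubalgebra ℂ C(UnitAddCircle, ℂ)),
      Tendsto (fun T => ∫ x, g x ∂(m T)) atTop (𝓝 (∫ x, g x)) := by
    intro g hg
    have hg' : g ∈ Submodule.span ℂ (Set.range (@fourier 1)) := by
      rw [← fourierSubalgebra_coe]; exact hg
    have hgi : ∀ (g : C(UnitAddCircle, ℂ)) (ν : Measure UnitAddCircle) [IsFiniteMeasure ν],
        Integrable g ν := fun g ν _ => 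
          (g.continuous.integrable_of_hasCompactSupport (HasCompactSupport.of_compactSpace g))
    induction hg' using Submodule.span_induction with
    | mem x hx =>
      obtain ⟨n, rfl⟩ := hx
      have e : ∀ t : ℝ, fourier n (t : UnitAddCircle) = Complex.exp (2 * π * Complex.I * n * t) := by
        intro t
        rw [fourier_coe_apply]; simp
      have e0 : n ≠ 0 → ∫ x : UnitAddCircle, fourier n x = 0 := by
        intro hn
        have hc : (2 * π * Complex.I * n : ℂ) ≠ 0 := by simp [Real.pi_ne_zero, hn]
        have hd : ∀ s : ℝ, HasDerivAt (fun s : ℝ => (2 * π * Complex.I * n)⁻¹ *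
            Complex.exp (2 * π * Complex.I * n * s)) (Complex.exp (2 * π * Complex.I * n * s)) s :=
          fun s => ((hasDerivAt_exp_two_pi_int n s).const_mul _).congr_deriv
            (inv_mul_cancel_left₀ hc _)
        rw [← UnitAddCircle.intervalIntegral_preimage 0]
        simp_rw [e]
        rw [intervalIntegral.integral_eq_sub_of_hasDerivAt (fun s _ => hd s)
          (Continuous.intervalIntegrable (by fun_prop) _ _)]
        have : Complex.exp (2 * π * Complex.I * n * ((0 : ℝ) + 1 : ℝ)) = 1 := by
          rw [Complex.exp_eq_one_iff]; exact ⟨n, by push_cast; ring⟩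
        rw [this]
        simp
      by_cases hn : n = 0
      · subst hn
        simp only [fourier_zero]
        simp
      · rw [e0 hn]
        refine (hd n hn).congr' ?_
        filter_upwards [eventually_ge_atTop 1] with T hT
        rw [hint _ T hT]
        simp_rw [e]
    | zero => simp
    | add x y _ _ hx hy =>
      simp only [ContinuousMap.add_apply]
      rw [integral_add (hgi x _) (hgi y _)]
      simp_rw [fun T => integral_add (hgi x (m T)) (hgi y (m T))]
      exact (hx (by rw [← fourierSubalgebra_coe] at *; assumption)).add
        (hy (by rw [← fourierSubalgebra_coe] at *; assumption))
    | smul c x _ hx =>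
      simp only [ContinuousMap.smul_apply]
      simp_rw [integral_smul]
      exact (hx (by rw [← fourierSubalgebra_coe] at *; assumption)).const_smul c
  have hlim : Tendsto μ atTop (𝓝 μ₀) := by
    -- The circle is compact, so tightness is automatic, and trigonometric polynomials separate
    -- points. Convergence on them therefore already forces weak convergence.
    refine ProbabilityMeasure.tendsto_of_tight_of_separatesPoints ℂ ?_
      (A := fourierSubalgebra.comap (BoundedContinuousFunction.toContinuousMapStarₐ ℂ)) ?_ ?_
    · exact IsTightMeasureSet.of_compactSpace
    · intro x y hxy
      obtain ⟨_, ⟨g, hg1, rfl⟩, hg2⟩ := fourierSubalgebra_separatesPoints hxy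
      refine ⟨_, ⟨g, ⟨BoundedContinuousFunction.mkOfCompact g, hg1, rfl⟩, rfl⟩, hg2⟩
    · intro g hg'
      exact hg _ hg'
  have hvol := volume_image_fract_le hs.1 hs.2
  have h2 := ProbabilityMeasure.tendsto_measure_of_null_frontier_of_tendsto' hlim (E :=
    ((↑) : ℝ → UnitAddCircle) '' {x : ℝ | Int.fract x ≤ s}) hvol.2
  have h3 := (ENNReal.tendsto_toReal (measure_ne_top _ _)).comp h2
  have h4 : ((μ₀ : Measure UnitAddCircle) (((↑) : ℝ → UnitAddCircle) ''
    {x : ℝ | Int.fract x ≤ s})).toReal = s := by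
    rw [hμ₀, ProbabilityMeasure.coe_mk, hvol.1, ENNReal.toReal_ofReal hs.1]
  rw [h4] at h3
  refine h3.congr' ?_
  filter_upwards [eventually_ge_atTop 1] with T hT
  have hE : MeasurableSet (((↑) : ℝ → UnitAddCircle) '' {x : ℝ | Int.fract x ≤ s}) :=
    (isClosed_image_fract_le hs.2).measurableSet
  simp only [Function.comp, hμ, ProbabilityMeasure.coe_mk, hm, max_eq_left hT]
  rw [Measure.smul_apply, Measure.map_apply hvm hE, Measure.restrict_apply (hvm hE),
    smul_eq_mul, ENNReal.toReal_mul, ENNReal.toReal_inv, ENNReal.toReal_ofReal (by linarith),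
    div_eq_inv_mul]
  congr 1
  have : (fun t : ℝ => (v t : UnitAddCircle)) ⁻¹' (((↑) : ℝ → UnitAddCircle) ''
      {x : ℝ | Int.fract x ≤ s}) = v ⁻¹' {x : ℝ | Int.fract x ≤ s} := by
    exact congrArg (v ⁻¹' ·) (preimage_image_fract_le s)
  rw [this, Set.inter_comm]
  rfl

/-! ### Benford functions and averages of `|f|^(iτ)` -/

/-- Taking logarithms turns significands into fractional parts. The convention `logb b 0 = 0` keeps
this valid at `x = 0`, where both inequalities hold. -/
theorem significand_le_iff {b : ℕ} (hb : 2 ≤ b) (x : ℝ) {s : ℝ} (hs : 1 ≤ s) :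
    significand b x ≤ s ↔ Int.fract (Real.logb b |x|) ≤ Real.logb b s := by
  have hb1 : (1 : ℝ) < b := by exact_mod_cast hb
  have hb0 : (0 : ℝ) < b := by linarith
  by_cases hx : x = 0
  · subst hx
    have : 0 ≤ Real.logb b s := Real.logb_nonneg hb1 hs
    simp only [significand_zero, abs_zero, Real.logb_zero, Int.fract_zero]
    exact ⟨fun _ => this, fun _ => by linarith⟩
  · have hx0 : 0 < |x| := abs_pos.mpr hx
    have hp : (0 : ℝ) < (b : ℝ) ^ ⌊Real.logb b |x|⌋ := zpow_pos hb0 _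
    have h1 : Int.fract (Real.logb b |x|) = Real.logb b (significand b x) := by
      rw [significand, Real.logb_div hx0.ne' hp.ne', ← Real.rpow_intCast,
        Real.logb_rpow hb0 hb1.ne', Int.fract]
    have hsig : 0 < significand b x := div_pos hx0 hp
    rw [h1, Real.logb_le_logb hb1 hsig (by linarith)]

theorem absCPow_eq_exp_logb (b : ℕ) (h : ℤ) {x : ℝ} (hx : x ≠ 0) :
    absCPow (2 * π * h / Real.log b) x = Complex.exp (2 * π * Complex.I * h * Real.logb b |x|) := by
  rw [absCPow_of_ne_zero _ hx, Real.logb]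
  push_cast
  congr 1
  ring

theorem logb_mem_Ico {b : ℕ} (hb : 2 ≤ b) {s : ℝ} (hs : s ∈ Set.Ico (1 : ℝ) b) :
    Real.logb b s ∈ Set.Ico (0 : ℝ) 1 := by
  have hb1 : (1 : ℝ) < b := by exact_mod_cast hb
  refine ⟨Real.logb_nonneg hb1 hs.1, ?_⟩
  rw [Real.logb_lt_iff_lt_rpow hb1 (by linarith [hs.1]), Real.rpow_one]
  exact hs.2

theorem isBenfordFunction_iff_density {b : ℕ} (hb : 2 ≤ b) {f : ℝ → ℝ} (hf : Measurable f) :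
    IsBenfordFunction b f ↔ ∀ s ∈ Set.Ico (0 : ℝ) 1, Tendsto (fun T : ℝ =>
      volume.real {t : ℝ | t ∈ Set.Icc 0 T ∧ Int.fract (Real.logb b |f t|) ≤ s} / T)
        atTop (𝓝 s) := by
  have hb1 : (1 : ℝ) < b := by exact_mod_cast hb
  have hb0 : (0 : ℝ) < b := by linarith
  constructor
  · rintro ⟨-, h⟩ s hs
    have h1 : (b : ℝ) ^ s ∈ Set.Ico (1 : ℝ) b :=
      ⟨Real.one_le_rpow hb1.le hs.1, by
        conv_rhs => rw [← Real.rpow_one (b : ℝ)]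
        exact Real.rpow_lt_rpow_of_exponent_lt hb1 hs.2⟩
    have h2 := h _ h1
    rw [Real.logb_rpow hb0 hb1.ne'] at h2
    simpa only [significand_le_iff hb _ h1.1, Real.logb_rpow hb0 hb1.ne'] using h2
  · intro h
    refine ⟨hf.comp measurable_subtype_coe, fun s hs => ?_⟩
    simpa only [significand_le_iff hb _ hs.1] using h _ (logb_mem_Ico hb hs)

theorem measurable_logb_abs {f : ℝ → ℝ} (hf : Measurable f) (b : ℕ) :
    Measurable fun t => Real.logb b |f t| :=
  (Real.measurable_log.comp (by fun_prop : Measurable fun t => |f t|)).div_const _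

theorem isBenfordFunction_of_tendsto_average_exp {b : ℕ} (hb : 2 ≤ b) {f : ℝ → ℝ}
    (hf : Measurable f) (h : ∀ h : ℤ, h ≠ 0 → Tendsto (fun T : ℝ => (T : ℂ)⁻¹ *
      ∫ t in (0 : ℝ)..T, Complex.exp (2 * π * Complex.I * h * Real.logb b |f t|)) atTop (𝓝 0)) :
    IsBenfordFunction b f :=
  (isBenfordFunction_iff_density hb hf).mpr fun _ hs =>
    tendsto_density_of_tendsto_average_exp (measurable_logb_abs hf b) h hs

/-- At a zero of `f` the function `|f|^(iτ)` is `0`, whereas the character of `logb b |f|` is `1`.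
The two averages have the same limit because the zero set of a Benford function has density zero. -/
theorem IsBenfordFunction.tendsto_average_absCPow {b : ℕ} (hb : 2 ≤ b) {f : ℝ → ℝ}
    (hf : Measurable f) (hB : IsBenfordFunction b f) {h : ℤ} (hh : h ≠ 0) :
    Tendsto (fun T : ℝ => (T : ℂ)⁻¹ *
      ∫ t in (0 : ℝ)..T, absCPow (2 * π * h / Real.log b) (f t)) atTop (𝓝 0) := by
  have hb1 : (1 : ℝ) < b := by exact_mod_cast hb
  have hlog : Real.log b ≠ 0 := (Real.log_pos hb1).ne'
  have hτ : 2 * π * h / Real.log b ≠ 0 := by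
    have : (h : ℝ) ≠ 0 := by exact_mod_cast hh
    positivity
  have hd := (isBenfordFunction_iff_density hb hf).mp hB
  have h1 := tendsto_average_exp_of_tendsto_density (measurable_logb_abs hf b) hd hh
  -- At level `0` the set contains all zeros of `f`, and its density is `0`.
  have h0 := hd 0 ⟨le_rfl, one_pos⟩
  have hz : MeasurableSet {t : ℝ | f t = 0} := hf (measurableSet_singleton 0)
  have h2 : Tendsto (fun T : ℝ => (T : ℂ)⁻¹ *
      ∫ t in (0 : ℝ)..T, {t : ℝ | f t = 0}.indicator (1 : ℝ → ℂ) t) atTop (𝓝 0) := by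
    refine squeeze_zero_norm' ?_ h0
    filter_upwards [eventually_gt_atTop 0] with T hT
    rw [intervalIntegral.integral_of_le hT.le, ← integral_Icc_eq_integral_Ioc,
      setIntegral_indicator hz]
    simp only [Pi.one_apply, integral_const]
    rw [measureReal_restrict_apply_univ, norm_mul, norm_inv, Complex.norm_real,
      Real.norm_of_nonneg hT.le, div_eq_inv_mul]
    simp only [Complex.real_smul, mul_one, Complex.norm_real, Real.norm_of_nonneg measureReal_nonneg]
    gcongr
    · exact ne_top_of_le_ne_top (by simp) (measure_mono (t := Set.Icc 0 T) fun t ht => ht.1)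
    · intro t ht
      refine ⟨ht.1, ?_⟩
      have : f t = 0 := ht.2
      simp [this]
  have h3 := h1.sub h2
  rw [sub_zero] at h3
  refine h3.congr fun T => ?_
  rw [← mul_sub, ← intervalIntegral.integral_sub]
  · congr 1
    refine intervalIntegral.integral_congr fun t _ => ?_
    by_cases ht : f t = 0
    · simp [ht, absCPow_zero hτ]
    · simp only [absCPow_eq_exp_logb b h ht]
      simp [ht]
  · have := measurable_logb_abs hf b
    exact intervalIntegrable_of_bounded (by fun_prop) (fun t => (norm_exp_two_pi_int h _).le) _ _
  · refine intervalIntegrable_of_bounded (C := 1) (measurable_one.indicator hz) (fun t => ?_) _ _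
    by_cases ht : f t = 0 <;> simp [ht]

/-! ### Resonance excludes the Benford property -/

/-- If the growth rate `a` is resonant with the frequencies `η`, then not all functions
`t ↦ e ^ (a t) Re ∑ z_j e ^ (i η_j t)` can be Benford or zero. -/
theorem exists_not_isBenfordFunction_of_resonance {ι : Type*} [Fintype ι] [Nonempty ι] {b : ℕ}
    (hb : 2 ≤ b) (a : ℝ) (η : ι → ℝ) (k : ι → ℕ) (hk : Even (∑ j, k j)) {M : ℤ} (hM : M ≠ 0)
    (h : 2 * π * M / Real.log b * a = ∑ j, k j * η j) :
    ∃ z : ι → ℂ, ¬ (IsBenfordFunction b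
      (fun t => Real.exp (a * t) * (∑ j, z j * Complex.exp (η j * t * Complex.I)).re) ∨
      ∀ t, Real.exp (a * t) * (∑ j, z j * Complex.exp (η j * t * Complex.I)).re = 0) := by
  by_contra! hcon
  have hb1 : (1 : ℝ) < b := by exact_mod_cast hb
  have hlog : Real.log b ≠ 0 := (Real.log_pos hb1).ne'
  set τ := 2 * π * M / Real.log b with hτ
  have hτ0 : τ ≠ 0 := by
    have : (M : ℝ) ≠ 0 := by exact_mod_cast hM
    positivity
  set μ := stdGaussian (EuclideanSpace ℂ ι)
  set f : EuclideanSpace ℂ ι → ℝ → ℝ := fun z t =>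
    Real.exp (a * t) * (∑ j, z j * Complex.exp (η j * t * Complex.I)).re with hf
  have hfc : Continuous (Function.uncurry f) := by
    simp only [hf, Function.uncurry_def]
    fun_prop
  have hlim : ∀ z, Tendsto (fun T : ℝ => (T : ℂ)⁻¹ * ∫ t in (0 : ℝ)..T, absCPow τ (f z t))
      atTop (𝓝 0) := by
    intro z
    have hm : Measurable (f z) := (hfc.comp (Continuous.prodMk_right z)).measurable
    rcases hcon z with h1 | h1
    · exact h1.tendsto_average_absCPow hb hm hM
    · have : ∀ t, f z t = 0 := h1
      simp [this, absCPow_zero hτ0]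
  set W : EuclideanSpace ℂ ι → ℂ := fun z => ∏ j, z j ^ k j with hW
  have hWi : Integrable W μ := integrable_prod_coord_pow k
  set C := ∫ z, W z * absCPow τ (∑ j, z j).re ∂μ with hC
  have hC0 : C ≠ 0 := integral_prod_coord_pow_mul_absCPow_ne_zero hτ0 k hk
  -- Rotating the coordinates by `e^(iη_j t)` multiplies the monomial by `e^(it ∑ k_j η_j)`. By
  -- resonance this is the phase `e^(iτat)` contributed by the growth factor, so the integrand at
  -- time `t` is the one at time `0` composed with an isometry.
  have hconst : ∀ t, ∫ z, W z * absCPow τ (f z t) ∂μ = C := by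
    intro t
    have hξ : ∀ j, ‖Complex.exp (η j * t * Complex.I)‖ = 1 := fun j => by
      rw [← Complex.ofReal_mul, Complex.norm_exp_ofReal_mul_I]
    set U := coordRotation (fun j => Complex.exp (η j * t * Complex.I)) hξ
    have e1 : ∀ z, W z * absCPow τ (f z t) = W (U z) * absCPow τ (∑ j, U z j).re := by
      intro z
      have e2 : W (U z) = Complex.exp ((∑ j, k j * η j : ℝ) * t * Complex.I) * W z := by
        simp only [hW, U, coordRotation_apply, mul_pow, Finset.prod_mul_distrib]
        congr 1
        simp_rw [← Complex.exp_nat_mul]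
        rw [← Complex.exp_sum]
        congr 1
        push_cast
        rw [Finset.sum_mul, Finset.sum_mul]
        exact Finset.sum_congr rfl fun j _ => by ring
      have e3 : absCPow τ (f z t) = Complex.exp ((∑ j, k j * η j : ℝ) * t * Complex.I) *
          absCPow τ (∑ j, U z j).re := by
        simp only [hf, absCPow_mul, U, coordRotation_apply]
        congr 1
        · rw [absCPow_of_ne_zero _ (Real.exp_pos _).ne', abs_of_pos (Real.exp_pos _),
            Real.log_exp, ← h]
          congr 1
          push_cast
          ring
        · simp_rw [mul_comm]
      rw [e2, e3]
      ring
    simp_rw [e1]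
    exact integral_stdGaussian_comp_isometry U fun z => W z * absCPow τ (∑ j, z j).re
  have hmeas : Measurable fun p : EuclideanSpace ℂ ι × ℝ => absCPow τ (f p.1 p.2) :=
    (measurable_absCPow τ).comp hfc.measurable
  have hmean : ∀ T : ℝ, 0 < T → ∫ z, W z * ((T : ℂ)⁻¹ * ∫ t in (0 : ℝ)..T, absCPow τ (f z t)) ∂μ
      = C := by
    intro T hT
    have hT' : (T : ℂ) ≠ 0 := by exact_mod_cast hT.ne'
    have hI : Integrable (Function.uncurry fun (z : EuclideanSpace ℂ ι) (t : ℝ) =>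
        W z * absCPow τ (f z t)) (μ.prod (volume.restrict (Set.Ioc 0 T))) := by
      exact (hWi.comp_fst _).mul_bdd (c := 1) hmeas.aestronglyMeasurable
        (ae_of_all _ fun _ => norm_absCPow_le _ _)
    have e1 : ∀ z, W z * ((T : ℂ)⁻¹ * ∫ t in (0 : ℝ)..T, absCPow τ (f z t)) =
        (T : ℂ)⁻¹ * ∫ t in Set.Ioc 0 T, W z * absCPow τ (f z t) := by
      intro z
      rw [intervalIntegral.integral_of_le hT.le, integral_const_mul]
      ring
    simp_rw [e1]
    rw [integral_const_mul, integral_integral_swap hI]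
    simp_rw [hconst]
    simp [hT', hT.le]
  -- Under the contrary assumption the time averages tend to zero for every `z`. They are bounded by
  -- `1`, so the integrable norm of the monomial dominates.
  have hlim2 : Tendsto (fun T : ℝ => ∫ z, W z * ((T : ℂ)⁻¹ * ∫ t in (0 : ℝ)..T,
      absCPow τ (f z t)) ∂μ) atTop (𝓝 (∫ z, W z * 0 ∂μ)) := by
    refine tendsto_integral_filter_of_dominated_convergence (fun z => ‖W z‖) ?_ ?_ hWi.norm ?_
    · filter_upwards [eventually_gt_atTop 0] with T hT
      refine hWi.aestronglyMeasurable.mul (AEStronglyMeasurable.const_mul ?_ _)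
      simp_rw [intervalIntegral.integral_of_le hT.le]
      exact (hmeas.stronglyMeasurable.integral_prod_right').aestronglyMeasurable
    · filter_upwards [eventually_gt_atTop 0] with T hT
      filter_upwards with z
      rw [norm_mul]
      refine mul_le_of_le_one_right (norm_nonneg _) ?_
      rw [norm_mul, norm_inv, Complex.norm_real, Real.norm_of_nonneg hT.le,
        inv_mul_le_iff₀ hT, mul_one]
      refine (intervalIntegral.norm_integral_le_of_norm_le_const (C := 1) fun t _ =>
        norm_absCPow_le _ _).trans_eq ?_
      simp [hT.le]
    · filter_upwards with z
      exact (hlim z).const_mul _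
  have hlim3 : Tendsto (fun _ : ℝ => C) atTop (𝓝 (∫ z, W z * 0 ∂μ)) := by
    refine hlim2.congr' ?_
    filter_upwards [eventually_gt_atTop 0] with T hT using hmean T hT
  have := tendsto_nhds_unique hlim3 tendsto_const_nhds
  simp at this
  exact hC0 this.symm

/-! ### Exponential polynomials -/

theorem Polynomial.exists_derivative_eq (p : Polynomial ℂ) :
    ∃ q : Polynomial ℂ, Polynomial.derivative q = p := by
  induction p using Polynomial.induction_on' with
  | add p q hp hq =>
    obtain ⟨p', hp'⟩ := hp
    obtain ⟨q', hq'⟩ := hq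
    exact ⟨p' + q', by rw [Polynomial.derivative_add, hp', hq']⟩
  | monomial n a =>
    refine ⟨Polynomial.monomial (n + 1) (a / (n + 1)), ?_⟩
    have : (n + 1 : ℂ) ≠ 0 := by exact_mod_cast Nat.succ_ne_zero n
    rw [Polynomial.derivative_monomial]
    simp [this]

theorem Polynomial.hasDerivAt_eval_ofReal (p : Polynomial ℂ) (t : ℝ) :
    HasDerivAt (fun t : ℝ => p.eval (t : ℂ)) ((Polynomial.derivative p).eval (t : ℂ)) t :=
  (p.hasDerivAt (t : ℂ)).comp_ofReal

/-- The exponential polynomials with exponents in a finite set. -/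
def IsExpPolynomial (S : Finset ℂ) (f : ℝ → ℂ) : Prop :=
  ∃ P : ℂ → Polynomial ℂ, ∀ t : ℝ, f t = ∑ w ∈ S, Complex.exp (w * t) * (P w).eval (t : ℂ)

theorem IsExpPolynomial.zero (S : Finset ℂ) : IsExpPolynomial S fun _ => 0 :=
  ⟨fun _ => 0, fun t => by simp⟩

theorem IsExpPolynomial.add {S : Finset ℂ} {f g : ℝ → ℂ} (hf : IsExpPolynomial S f)
    (hg : IsExpPolynomial S g) : IsExpPolynomial S fun t => f t + g t := by
  obtain ⟨P, hP⟩ := hf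
  obtain ⟨Q, hQ⟩ := hg
  refine ⟨fun w => P w + Q w, fun t => ?_⟩
  simp only [hP, hQ]
  rw [← Finset.sum_add_distrib]
  exact Finset.sum_congr rfl fun w _ => by rw [Polynomial.eval_add]; ring

theorem IsExpPolynomial.sum {S : Finset ℂ} {α : Type*} (s : Finset α) {f : α → ℝ → ℂ}
    (hf : ∀ i ∈ s, IsExpPolynomial S (f i)) : IsExpPolynomial S fun t => ∑ i ∈ s, f i t := by
  classical
  induction s using Finset.induction_on with
  | empty => simpa using IsExpPolynomial.zero S
  | insert a s ha ih =>
    simp_rw [Finset.sum_insert ha]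
    exact (hf a (Finset.mem_insert_self a s)).add
      (ih fun i hi => hf i (Finset.mem_insert_of_mem hi))

theorem isExpPolynomial_single {S : Finset ℂ} {w : ℂ} (hw : w ∈ S) (p : Polynomial ℂ) :
    IsExpPolynomial S fun t => Complex.exp (w * t) * p.eval (t : ℂ) := by
  classical
  refine ⟨fun z => if z = w then p else 0, fun t => ?_⟩
  rw [Finset.sum_eq_single_of_mem w hw]
  · simp
  · intro z _ hz
    simp [hz]

/-! ### Functionals of a linear flow as exponential polynomials -/

namespace LinearFlow

open TensorProduct

variable {X : Type*} [NormedAddCommGroup X] [NormedSpace ℝ X] (φ : LinearFlow X)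

/-- The complexification of the generator of a linear flow. -/
noncomputable def complexGenerator : Module.End ℂ (ℂ ⊗[ℝ] X) :=
  LinearMap.baseChange ℂ (φ.generator : X →ₗ[ℝ] X)

/-- A coordinate of an orbit of the complexified flow. -/
noncomputable def complexOrbit (l : (ℂ ⊗[ℝ] X) →ₗ[ℂ] ℂ) (v : ℂ ⊗[ℝ] X) (t : ℝ) : ℂ :=
  l ((φ.timeMap t : X →ₗ[ℝ] X).baseChange ℂ v)

theorem complexOrbit_zero (l : (ℂ ⊗[ℝ] X) →ₗ[ℂ] ℂ) (v : ℂ ⊗[ℝ] X) :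
    φ.complexOrbit l v 0 = l v := by
  have : ((1 : X →L[ℝ] X) : X →ₗ[ℝ] X) = LinearMap.id := rfl
  rw [complexOrbit, timeMap_zero, this, LinearMap.baseChange_id]
  rfl

/-- Evaluation of the complexification of an operator, as a real linear map. -/
noncomputable def complexEval (l : (ℂ ⊗[ℝ] X) →ₗ[ℂ] ℂ) (v : ℂ ⊗[ℝ] X) :
    (X →L[ℝ] X) →ₗ[ℝ] ℂ where
  toFun T := l ((T : X →ₗ[ℝ] X).baseChange ℂ v)
  map_add' S T := by
    rw [ContinuousLinearMap.toLinearMap_add, LinearMap.baseChange_add, LinearMap.add_apply, map_add]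
  map_smul' c T := by
    rw [ContinuousLinearMap.toLinearMap_smul, LinearMap.baseChange_smul, LinearMap.smul_apply,
      LinearMap.map_smul_of_tower, RingHom.id_apply]

variable [FiniteDimensional ℝ X]

theorem hasDerivAt_timeMap' (t : ℝ) :
    HasDerivAt φ.timeMap (φ.timeMap t * φ.generator) t := by
  have : CompleteSpace X := FiniteDimensional.complete ℝ X
  have h0 : HasDerivAt φ.timeMap φ.generator (t - t) := by
    rw [sub_self]; exact φ.hasDerivAt_timeMap
  have h1 : HasDerivAt (fun s => φ.timeMap t * φ.timeMap (s - t))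
      (φ.timeMap t * φ.generator) t := (h0.comp_sub_const t t).const_mul (φ.timeMap t)
  convert h1 using 1
  funext s
  rw [← timeMap_add, add_sub_cancel]

theorem hasDerivAt_complexOrbit (l : (ℂ ⊗[ℝ] X) →ₗ[ℂ] ℂ) (v : ℂ ⊗[ℝ] X) (t : ℝ) :
    HasDerivAt (φ.complexOrbit l v) (φ.complexOrbit l (φ.complexGenerator v) t) t := by
  have h := (LinearMap.toContinuousLinearMap (complexEval l v)).hasFDerivAt.comp_hasDerivAt t
    (φ.hasDerivAt_timeMap' t)
  refine h.congr_deriv ?_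
  change l (((φ.timeMap t * φ.generator : X →L[ℝ] X) : X →ₗ[ℝ] X).baseChange ℂ v) = _
  have : ((φ.timeMap t * φ.generator : X →L[ℝ] X) : X →ₗ[ℝ] X) =
    (φ.timeMap t : X →ₗ[ℝ] X) ∘ₗ (φ.generator : X →ₗ[ℝ] X) := rfl
  rw [this, LinearMap.baseChange_comp]
  rfl

/-- The factor `e^(-wt)` replaces the generator `A` by `A - w`, which is nilpotent on generalized
eigenvectors for `w`. -/
theorem hasDerivAt_exp_mul_complexOrbit (l : (ℂ ⊗[ℝ] X) →ₗ[ℂ] ℂ) (v : ℂ ⊗[ℝ] X) (w : ℂ) (t : ℝ) :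
    HasDerivAt (fun t : ℝ => Complex.exp (-(w * t)) * φ.complexOrbit l v t)
      (Complex.exp (-(w * t)) *
        φ.complexOrbit l ((φ.complexGenerator - algebraMap ℂ _ w) v) t) t := by
  have h1 : HasDerivAt (fun t : ℝ => Complex.exp (-(w * t)))
      (Complex.exp (-(w * t)) * -(w * (1 : ℝ))) t :=
    (((hasDerivAt_id t).ofReal_comp.const_mul w).neg).cexp
  refine (h1.mul (φ.hasDerivAt_complexOrbit l v t)).congr_deriv ?_
  have : φ.complexOrbit l ((φ.complexGenerator - algebraMap ℂ _ w) v) t =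
      φ.complexOrbit l (φ.complexGenerator v) t - w * φ.complexOrbit l v t := by
    simp only [complexOrbit, LinearMap.sub_apply, Module.algebraMap_end_apply, map_sub, map_smul,
      smul_eq_mul]
  rw [this]
  push_cast
  ring

/-- By induction on the nilpotency order, `e^(-wt)` times the orbit has a polynomial derivative,
hence is itself a polynomial. -/
theorem complexOrbit_eq_exp_mul_polynomial (l : (ℂ ⊗[ℝ] X) →ₗ[ℂ] ℂ) (w : ℂ) (k : ℕ) :
    ∀ v : ℂ ⊗[ℝ] X, ((φ.complexGenerator - algebraMap ℂ _ w) ^ k) v = 0 →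
      ∃ p : Polynomial ℂ, ∀ t : ℝ, φ.complexOrbit l v t = Complex.exp (w * t) * p.eval (t : ℂ) := by
  induction k with
  | zero =>
    intro v hv
    have hv : v = 0 := hv
    exact ⟨0, fun t => by simp [complexOrbit, hv]⟩
  | succ k ih =>
    intro v hv
    obtain ⟨p, hp⟩ := ih ((φ.complexGenerator - algebraMap ℂ _ w) v) (by
      rw [pow_succ] at hv; exact hv)
    obtain ⟨q, hq⟩ := Polynomial.exists_derivative_eq p
    have hd : ∀ t : ℝ, HasDerivAt (fun t : ℝ => Complex.exp (-(w * t)) * φ.complexOrbit l v t -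
        q.eval (t : ℂ)) 0 t := by
      intro t
      refine ((φ.hasDerivAt_exp_mul_complexOrbit l v w t).sub
        (Polynomial.hasDerivAt_eval_ofReal q t)).congr_deriv ?_
      rw [hq, hp, ← mul_assoc, ← Complex.exp_add]
      simp
    have hc := is_const_of_deriv_eq_zero (fun t => (hd t).differentiableAt) fun t => (hd t).deriv
    refine ⟨q + Polynomial.C (l v - q.eval 0), fun t => ?_⟩
    have h1 := hc t 0
    simp only [complexOrbit_zero] at h1
    have h2 : Complex.exp (-(w * t)) * φ.complexOrbit l v t = q.eval (t : ℂ) + (l v - q.eval 0) := by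
      rw [← sub_eq_iff_eq_add', h1]
      simp
    rw [Polynomial.eval_add, Polynomial.eval_C, ← h2, ← mul_assoc, ← Complex.exp_add]
    simp

theorem finite_spectrum : φ.spectrum.Finite := φ.complexGenerator.finite_hasEigenvalue

/-- Over `ℂ` the generalized eigenspaces span. A component for a number outside the spectrum is
zero, since `A - w` and all its powers are then injective. -/
theorem isExpPolynomial_complexOrbit (l : (ℂ ⊗[ℝ] X) →ₗ[ℂ] ℂ) (v : ℂ ⊗[ℝ] X) :
    IsExpPolynomial φ.finite_spectrum.toFinset (φ.complexOrbit l v) := by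
  have hv : v ∈ ⨆ w, φ.complexGenerator.maxGenEigenspace w := by
    rw [Module.End.iSup_maxGenEigenspace_eq_top]; trivial
  induction hv using Submodule.iSup_induction' with
  | mem w v hv =>
    obtain ⟨k, hk⟩ := (Module.End.mem_maxGenEigenspace _ _ _).mp hv
    by_cases hw : w ∈ φ.spectrum
    · obtain ⟨p, hp⟩ := φ.complexOrbit_eq_exp_mul_polynomial l w k v hk
      have := isExpPolynomial_single (φ.finite_spectrum.mem_toFinset.mpr hw) p
      rwa [← funext hp] at this
    · have hinj : Function.Injective (φ.complexGenerator -
          algebraMap ℂ (Module.End ℂ (ℂ ⊗[ℝ] X)) w) := by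
        rw [← LinearMap.ker_eq_bot]
        by_contra hne
        refine hw ?_
        change Module.End.HasEigenvalue φ.complexGenerator w
        rwa [Module.End.hasEigenvalue_iff, Module.End.eigenspace_def]
      have hv0 : v = 0 := by
        have : Function.Injective ((φ.complexGenerator -
            algebraMap ℂ (Module.End ℂ (ℂ ⊗[ℝ] X)) w) ^ k) := by
          rw [Module.End.coe_pow]
          exact hinj.iterate k
        exact this (hk.trans (map_zero _).symm)
      have : φ.complexOrbit l v = fun _ => 0 := by
        funext t; simp [complexOrbit, hv0]
      rw [this]; exact IsExpPolynomial.zero _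
  | zero =>
    have : φ.complexOrbit l 0 = fun _ => 0 := by
      funext t; simp [complexOrbit]
    rw [this]; exact IsExpPolynomial.zero _
  | add x y _ _ hx hy =>
    have : φ.complexOrbit l (x + y) = fun t => φ.complexOrbit l x t + φ.complexOrbit l y t := by
      funext t; simp [complexOrbit]
    rw [this]; exact hx.add hy

/-- In a basis `e`, an operator `T` is the sum of the rank-one maps `x ↦ e_j^*(x) T e_j`. Hence `H`
is a sum of linear functionals of the orbits of the basis vectors. -/
theorem isExpPolynomial_functional (H : (X →L[ℝ] X) →ₗ[ℝ] ℝ) :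
    IsExpPolynomial φ.finite_spectrum.toFinset fun t => (H (φ.timeMap t) : ℂ) := by
  set e := Module.finBasis ℝ X
  set η : Fin (Module.finrank ℝ X) → X →ₗ[ℝ] ℝ := fun j =>
    { toFun := fun x => H ((LinearMap.toContinuousLinearMap (e.coord j)).smulRight x)
      map_add' := fun x y => by rw [← map_add]; congr 1; ext z; simp
      map_smul' := fun c x => by
        rw [RingHom.id_apply, ← map_smul]; congr 1; ext z; simp [smul_comm c] } with hη
  set l : Fin (Module.finrank ℝ X) → (ℂ ⊗[ℝ] X) →ₗ[ℂ] ℂ := fun j =>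
    (AlgebraTensorModule.rid ℝ ℂ ℂ).toLinearMap ∘ₗ (η j).baseChange ℂ with hl
  have key : ∀ t, (H (φ.timeMap t) : ℂ) = ∑ j, φ.complexOrbit (l j) (1 ⊗ₜ e j) t := by
    intro t
    have h1 : φ.timeMap t = ∑ j, (LinearMap.toContinuousLinearMap (e.coord j)).smulRight
        (φ.timeMap t (e j)) := by
      refine ContinuousLinearMap.coe_injective (e.ext fun i => ?_)
      simp [Finsupp.single_apply]
    conv_lhs => rw [h1]
    rw [map_sum, Complex.ofReal_sum]
    refine Finset.sum_congr rfl fun j _ => ?_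
    simp [complexOrbit, hl, hη]
  rw [funext key]
  exact IsExpPolynomial.sum _ fun j _ => φ.isExpPolynomial_complexOrbit _ _

/-- Pairing an eigenvector `v` with a dual vector equal to `1` on it gives exactly `e^(wt)`. The
constant `c` is absorbed in the dual vector. -/
theorem exists_functional_eq_re_exp {w : ℂ} (hw : w ∈ φ.spectrum) (c : ℂ) :
    ∃ H : (X →L[ℝ] X) →ₗ[ℝ] ℝ, ∀ t : ℝ, H (φ.timeMap t) = (c * Complex.exp (w * t)).re := by
  obtain ⟨v, hv⟩ := Module.End.HasEigenvalue.exists_hasEigenvector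
    (show Module.End.HasEigenvalue φ.complexGenerator w from hw)
  obtain ⟨l, hl⟩ := Module.Projective.exists_dual_eq_one ℂ hv.2
  have hv1 : (φ.complexGenerator - algebraMap ℂ _ w) v = 0 := by
    rw [LinearMap.sub_apply, hv.apply_eq_smul]
    simp
  have hd : ∀ t : ℝ, HasDerivAt (fun t : ℝ => Complex.exp (-(w * t)) * φ.complexOrbit l v t)
      0 t := by
    intro t
    refine (φ.hasDerivAt_exp_mul_complexOrbit l v w t).congr_deriv ?_
    rw [hv1]
    simp [complexOrbit]
  have hc := is_const_of_deriv_eq_zero (fun t => (hd t).differentiableAt) fun t => (hd t).deriv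
  have ho : ∀ t : ℝ, φ.complexOrbit l v t = Complex.exp (w * t) := by
    intro t
    have := hc t 0
    simp only [complexOrbit_zero, hl, Complex.ofReal_zero, mul_zero, neg_zero, Complex.exp_zero,
      mul_one] at this
    rw [← mul_one (Complex.exp (w * t)), ← this, ← mul_assoc, ← Complex.exp_add]
    simp
  refine ⟨Complex.reLm ∘ₗ (complexEval (c • l) v), fun t => ?_⟩
  rw [← ho]
  rfl

theorem measurable_functional (H : (X →L[ℝ] X) →ₗ[ℝ] ℝ) :
    Measurable fun t => H (φ.timeMap t) :=
  ((LinearMap.continuous_of_finiteDimensional H).comp φ.continuous_timeMap).measurable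

end LinearFlow

/-! ### Trigonometric polynomials and how rarely they are small -/

/-- Dedekind's independence of characters; the derivative at `0` recovers the frequency, so distinct
frequencies give distinct characters. -/
theorem linearIndependent_exp_mul_I {ι : Type*} {η : ι → ℝ} (hη : Function.Injective η) :
    LinearIndependent ℂ fun (j : ι) (t : ℝ) => Complex.exp (η j * t * Complex.I) := by
  let χ : ι → (Multiplicative ℝ →* ℂ) := fun j =>
    { toFun := fun t => Complex.exp (η j * (t.toAdd : ℝ) * Complex.I)
      map_one' := by simp
      map_mul' := fun s t => by
        rw [← Complex.exp_add, toAdd_mul]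
        push_cast
        ring_nf }
  have hχ : Function.Injective χ := by
    intro i j hij
    refine hη ?_
    have h1 : ∀ j : ι, HasDerivAt (fun t : ℝ => χ j (Multiplicative.ofAdd t))
        (η j * Complex.I) 0 := by
      intro j
      have := (((hasDerivAt_id (0 : ℝ)).ofReal_comp.const_mul (η j : ℂ)).mul_const Complex.I).cexp
      refine this.congr_deriv ?_
      simp
    have h2 := h1 i
    rw [hij] at h2
    have h3 := h2.unique (h1 j)
    exact_mod_cast mul_right_cancel₀ Complex.I_ne_zero h3
  exact (linearIndependent_monoidHom (Multiplicative ℝ) ℂ).comp χ hχ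

section

variable {ι : Type*} [Fintype ι]

/-- A trigonometric polynomial with prescribed coefficients and frequencies. -/
noncomputable def trigSum (η : ι → ℝ) (c : ι → ℂ) (t : ℝ) : ℂ :=
  ∑ j, c j * Complex.exp (η j * t * Complex.I)

theorem continuous_trigSum (η : ι → ℝ) (c : ι → ℂ) : Continuous (trigSum η c) := by
  unfold trigSum; fun_prop

theorem norm_exp_mul_I (x t : ℝ) : ‖Complex.exp (x * t * Complex.I)‖ = 1 := by
  rw [← Complex.ofReal_mul, Complex.norm_exp_ofReal_mul_I]

theorem norm_trigSum_le (η : ι → ℝ) (c : ι → ℂ) (t : ℝ) : ‖trigSum η c t‖ ≤ ∑ j, ‖c j‖ :=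
  (norm_sum_le _ _).trans_eq (Finset.sum_congr rfl fun j _ => by
    rw [norm_mul, norm_exp_mul_I, mul_one])

/-- A real-analytic function that is not identically zero has a discrete zero set. -/
theorem volume_trigSum_eq_zero {η : ι → ℝ} (hη : Function.Injective η) {c : ι → ℂ} (hc : c ≠ 0) :
    volume {t | trigSum η c t = 0} = 0 := by
  have han : AnalyticOnNhd ℝ (trigSum η c) Set.univ := by
    intro t _
    refine Finset.analyticAt_fun_sum _ fun j _ => analyticAt_const.mul ?_
    have h1 : AnalyticAt ℝ (fun z : ℂ => Complex.exp (η j * z * Complex.I)) (t : ℂ) :=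
      AnalyticAt.restrictScalars (𝕜' := ℂ) (by fun_prop)
    exact h1.comp (Complex.ofRealCLM.analyticAt t)
  obtain ⟨t, ht⟩ : ∃ t, trigSum η c t ≠ 0 := by
    by_contra! h
    refine hc (funext fun j => ?_)
    refine Fintype.linearIndependent_iff.mp (linearIndependent_exp_mul_I hη) c ?_ j
    funext t
    simpa [trigSum] using h t
  have h := han.preimage_zero_mem_codiscrete ht
  have h2 := ae_restrict_le_codiscreteWithin (μ := volume) MeasurableSet.univ h
  rw [Measure.restrict_univ] at h2
  rw [mem_ae_iff, ← Set.preimage_compl, compl_compl] at h2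
  exact h2

theorem exists_volume_trigSum_small {η : ι → ℝ} (hη : Function.Injective η) {c : ι → ℂ}
    (hc : c ≠ 0) {δ : ENNReal} (hδ : 0 < δ) :
    ∃ ε > 0, volume {t ∈ Set.Icc (0 : ℝ) 1 | ‖trigSum η c t‖ < ε} ≤ δ := by
  set s : ℕ → Set ℝ := fun n => {t ∈ Set.Icc (0 : ℝ) 1 | ‖trigSum η c t‖ < 1 / ((n : ℝ) + 1)}
  have hs : Antitone s := by
    intro m n hmn t ht
    exact ⟨ht.1, ht.2.trans_le (one_div_le_one_div_of_le (by positivity) (by gcongr))⟩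
  have hm : ∀ n, MeasurableSet (s n) := fun n =>
    measurableSet_Icc.inter (measurableSet_lt (continuous_trigSum η c).norm.measurable
      measurable_const)
  have hlim := tendsto_measure_iInter_atTop (μ := volume) (fun n => (hm n).nullMeasurableSet) hs
    ⟨0, ne_top_of_le_ne_top (by simp) (measure_mono (t := Set.Icc (0 : ℝ) 1) fun t ht => ht.1)⟩
  have h0 : volume (⋂ n, s n) = 0 := by
    refine measure_mono_null (fun t ht => ?_) (volume_trigSum_eq_zero hη hc)
    have h1 : ∀ n : ℕ, ‖trigSum η c t‖ ≤ 1 / ((n : ℝ) + 1) := fun n =>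
      (Set.mem_iInter.mp ht n).2.le
    have := ge_of_tendsto' tendsto_one_div_add_atTop_nhds_zero_nat h1
    exact norm_le_zero_iff.mp this
  rw [h0] at hlim
  obtain ⟨n, hn⟩ := (hlim.eventually_le_const hδ).exists
  exact ⟨1 / ((n : ℝ) + 1), by positivity, hn⟩

/-- A nonzero trigonometric polynomial takes small values only on a small portion of each interval
of unit length, uniformly in the interval. -/
theorem exists_volume_trigSum_small_uniform {η : ι → ℝ} (hη : Function.Injective η) {c : ι → ℂ}
    (hc : c ≠ 0) {δ : ENNReal} (hδ : 0 < δ) :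
    ∃ ε > 0, ∀ s : ℝ, volume {t ∈ Set.Icc s (s + 1) | ‖trigSum η c t‖ < ε} ≤ δ := by
  -- Translating time by `s` multiplies each coefficient by a unimodular number. Uniformity in `s`
  -- thus follows from uniformity over this compact torus.
  set K : Set (ι → ℂ) := Set.univ.pi fun _ => Metric.sphere (0 : ℂ) 1 with hK
  have hKc : IsCompact K := isCompact_univ_pi fun _ => isCompact_sphere _ _
  have key : ∃ ε > 0, ∀ u ∈ K, volume {t ∈ Set.Icc (0 : ℝ) 1 |
      ‖trigSum η (fun j => c j * u j) t‖ < ε} ≤ δ := by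
    refine hKc.induction_on (p := fun S => ∃ ε > 0, ∀ u ∈ S, volume {t ∈ Set.Icc (0 : ℝ) 1 |
      ‖trigSum η (fun j => c j * u j) t‖ < ε} ≤ δ) ?_ ?_ ?_ ?_
    · exact ⟨1, one_pos, fun u hu => hu.elim⟩
    · rintro S S' hSS ⟨ε, hε, h⟩
      exact ⟨ε, hε, fun u hu => h u (hSS hu)⟩
    · rintro S S' ⟨ε, hε, h⟩ ⟨ε', hε', h'⟩
      refine ⟨min ε ε', lt_min hε hε', ?_⟩
      rintro u (hu | hu)
      · refine le_trans (measure_mono ?_) (h u hu)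
        exact fun t ht => ⟨ht.1, ht.2.trans_le (min_le_left _ _)⟩
      · refine le_trans (measure_mono ?_) (h' u hu)
        exact fun t ht => ⟨ht.1, ht.2.trans_le (min_le_right _ _)⟩
    · intro u hu
      have hu0 : (fun j => c j * u j) ≠ 0 := by
        intro h
        refine hc (funext fun j => ?_)
        have h1 : ‖u j‖ = 1 := by simpa using hu j trivial
        exact (mul_eq_zero.mp (congrFun h j)).resolve_right (norm_ne_zero_iff.mp
          (by rw [h1]; exact one_ne_zero))
      obtain ⟨ε, hε, h⟩ := exists_volume_trigSum_small hη hu0 hδ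
      have hcont : Continuous fun u' : ι → ℂ => ∑ j, ‖c j * (u' j - u j)‖ := by fun_prop
      have hnear : ∀ᶠ u' in 𝓝 u, ∑ j, ‖c j * (u' j - u j)‖ < ε / 2 := by
        refine hcont.continuousAt.eventually_lt_const ?_
        simpa using half_pos hε
      -- Coefficients within `ε / 2` in the `ℓ¹` sense change the sum by less than `ε / 2` at all
      -- times, so halving the threshold suffices nearby.
      refine ⟨_, mem_nhdsWithin_of_mem_nhds hnear, ε / 2, half_pos hε, fun u' hu' => ?_⟩
      refine le_trans (measure_mono ?_) h
      intro t ht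
      refine ⟨ht.1, ?_⟩
      have e : trigSum η (fun j => c j * u j) t = trigSum η (fun j => c j * u' j) t -
          trigSum η (fun j => c j * (u' j - u j)) t := by
        simp only [trigSum, ← Finset.sum_sub_distrib]
        exact Finset.sum_congr rfl fun j _ => by ring
      rw [e]
      have h1 := norm_sub_le (trigSum η (fun j => c j * u' j) t)
        (trigSum η (fun j => c j * (u' j - u j)) t)
      have h2 := norm_trigSum_le η (fun j => c j * (u' j - u j)) t
      have h3 : ∑ j, ‖c j * (u' j - u j)‖ < ε / 2 := hu'
      linarith [ht.2]
  obtain ⟨ε, hε, h⟩ := key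
  refine ⟨ε, hε, fun s => ?_⟩
  have hu : (fun j => Complex.exp (η j * s * Complex.I)) ∈ K := fun j _ => by
    simp [norm_exp_mul_I]
  refine le_trans (le_of_eq ?_) (h _ hu)
  rw [← measure_preimage_add_right volume s]
  congr 1
  ext t
  have e : trigSum η (fun j => c j * Complex.exp (η j * s * Complex.I)) t = trigSum η c (t + s) := by
    refine Finset.sum_congr rfl fun j _ => ?_
    rw [mul_assoc, ← Complex.exp_add]
    push_cast
    ring_nf
  simp only [Set.mem_preimage, Set.mem_ofPred_eq, Set.mem_Icc, e]
  constructor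
  · rintro ⟨⟨a, b⟩, c⟩; exact ⟨⟨by linarith, by linarith⟩, c⟩
  · rintro ⟨⟨a, b⟩, c⟩; exact ⟨⟨by linarith, by linarith⟩, c⟩

theorem exists_density_trigSum_small {η : ι → ℝ} (hη : Function.Injective η) {c : ι → ℂ}
    (hc : c ≠ 0) {δ : ℝ} (hδ : 0 < δ) :
    ∃ ε > 0, ∀ T : ℝ, 0 ≤ T →
      volume.real {t ∈ Set.Icc 0 T | ‖trigSum η c t‖ < ε} ≤ δ * (T + 1) := by
  obtain ⟨ε, hε, h⟩ := exists_volume_trigSum_small_uniform hη hc (ENNReal.ofReal_pos.mpr hδ)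
  refine ⟨ε, hε, fun T hT => ?_⟩
  have hsub : {t ∈ Set.Icc 0 T | ‖trigSum η c t‖ < ε} ⊆ ⋃ n ∈ Finset.range (⌊T⌋₊ + 1),
      {t ∈ Set.Icc (n : ℝ) (n + 1) | ‖trigSum η c t‖ < ε} := by
    rintro t ⟨ht, ht2⟩
    simp only [Set.mem_iUnion]
    refine ⟨⌊t⌋₊, Finset.mem_range.mpr (Nat.lt_succ_of_le (Nat.floor_mono ht.2)),
      ⟨Nat.floor_le ht.1, (Nat.lt_floor_add_one t).le⟩, ht2⟩
  have h1 : volume {t ∈ Set.Icc 0 T | ‖trigSum η c t‖ < ε} ≤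
      ENNReal.ofReal (δ * (T + 1)) := by
    calc _ ≤ _ := measure_mono hsub
      _ ≤ ∑ n ∈ Finset.range (⌊T⌋₊ + 1), volume {t ∈ Set.Icc (n : ℝ) (n + 1) |
        ‖trigSum η c t‖ < ε} := measure_biUnion_finset_le _ _
      _ ≤ ∑ n ∈ Finset.range (⌊T⌋₊ + 1), ENNReal.ofReal δ := Finset.sum_le_sum fun n _ => h n
      _ = ENNReal.ofReal (δ * (⌊T⌋₊ + 1)) := by
        rw [Finset.sum_const, Finset.card_range, nsmul_eq_mul, mul_comm δ,
          ENNReal.ofReal_mul (by positivity)]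
        congr 1
        rw [← Nat.cast_succ, ENNReal.ofReal_natCast]
      _ ≤ _ := ENNReal.ofReal_le_ofReal (by gcongr; exact Nat.floor_le hT)
  exact ENNReal.toReal_le_of_le_ofReal (by positivity) h1

end

/-! ### Vanishing averages and slowly varying phases -/

/-- The averages of `q` over `[0, T]` tend to zero. -/
def AverageTendstoZero (q : ℝ → ℂ) : Prop :=
  Tendsto (fun T : ℝ => (T : ℂ)⁻¹ * ∫ t in (0 : ℝ)..T, q t) atTop (𝓝 0)

/-- Errors before a fixed time disappear in the average, and errors on a set of small density cost
little. The constant `3` is enough for a function of modulus one and an approximant of modulus at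
most `2`. -/
theorem averageTendstoZero_of_approx {E : ℝ → ℂ} (hE : Measurable E) (hEb : ∀ t, ‖E t‖ ≤ 1)
    (h : ∀ δ : ℝ, 0 < δ → ∃ Q : ℝ → ℂ, ∃ N : Set ℝ, ∃ C t₀ : ℝ, Measurable Q ∧
      (∀ t, ‖Q t‖ ≤ C) ∧ AverageTendstoZero Q ∧ MeasurableSet N ∧
      (∀ T, 0 ≤ T → volume.real (N ∩ Set.Icc 0 T) ≤ δ * (T + 1)) ∧ 
      ∀ t, t₀ ≤ t → ‖E t - Q t‖ ≤ δ + N.indicator (fun _ => (3 : ℝ)) t) :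
    AverageTendstoZero E := by
  rw [AverageTendstoZero, Metric.tendsto_atTop]
  intro ε hε
  -- Of `ε`, the average of `Q` uses `1/16`, the initial segment `1/16`, and the tail `7/16`; the
  -- last uses `T + 1 ≤ 2T`.
  obtain ⟨Q, N, C, t₀, hQ, hQb, hQ0, hN, hNd, hEQ⟩ := h (ε / 16) (by positivity)
  have hC : 0 ≤ C := (norm_nonneg _).trans (hQb 0)
  set t₁ := max t₀ 0 with ht₁
  have ht₁0 : 0 ≤ t₁ := le_max_right _ _
  obtain ⟨T₀, hT₀⟩ := (Metric.tendsto_atTop.mp hQ0) (ε / 16) (by positivity)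
  refine ⟨max (max T₀ 1) (max t₁ ((1 + C) * t₁ * (16 / ε))), fun T hT => ?_⟩
  have hT1 : 1 ≤ T := (le_max_right _ _).trans ((le_max_left _ _).trans hT)
  have hTt : t₁ ≤ T := (le_max_left _ _).trans ((le_max_right _ _).trans hT)
  have hTC : (1 + C) * t₁ * (16 / ε) ≤ T := (le_max_right _ _).trans ((le_max_right _ _).trans hT)
  have hT0 := hT₀ T ((le_max_left _ _).trans ((le_max_left _ _).trans hT))
  have hTpos : 0 < T := by linarith
  rw [dist_zero_right] at hT0 ⊢
  have hEi : ∀ a b, IntervalIntegrable E volume a b := intervalIntegrable_of_bounded hE hEb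
  have hQi : ∀ a b, IntervalIntegrable Q volume a b := intervalIntegrable_of_bounded hQ hQb
  have e1 : (T : ℂ)⁻¹ * ∫ t in (0 : ℝ)..T, E t = (T : ℂ)⁻¹ * (∫ t in (0 : ℝ)..T, Q t) +
      ((T : ℂ)⁻¹ * (∫ t in (0 : ℝ)..t₁, E t - Q t) + (T : ℂ)⁻¹ * ∫ t in t₁..T, E t - Q t) := by
    rw [← mul_add, intervalIntegral.integral_add_adjacent_intervals
      ((hEi _ _).sub (hQi _ _)) ((hEi _ _).sub (hQi _ _)),
      intervalIntegral.integral_sub (hEi _ _) (hQi _ _)]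
    ring
  have b1 : ‖∫ t in (0 : ℝ)..t₁, E t - Q t‖ ≤ (1 + C) * t₁ := by
    refine (intervalIntegral.norm_integral_le_of_norm_le_const (C := 1 + C) fun t _ =>
      (norm_sub_le _ _).trans (add_le_add (hEb t) (hQb t))).trans_eq ?_
    rw [sub_zero, abs_of_nonneg ht₁0]
  have hfin : volume (N ∩ Set.Icc 0 T) ≠ ⊤ :=
    ne_top_of_le_ne_top (by simp) (measure_mono (t := Set.Icc 0 T) Set.inter_subset_right)
  have hind : IntervalIntegrable (N.indicator fun _ => (3 : ℝ)) volume t₁ T := by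
    refine (intervalIntegrable_const (c := (3 : ℝ))).mono_fun
      (measurable_const.indicator hN).aestronglyMeasurable ?_
    filter_upwards with t
    exact norm_indicator_le_norm_self _ _
  have b2 : ‖∫ t in t₁..T, E t - Q t‖ ≤ ε / 16 * T + 3 * (ε / 16 * (T + 1)) := by
    calc _ ≤ ∫ t in t₁..T, (ε / 16 + N.indicator (fun _ => (3 : ℝ)) t) := by
          refine intervalIntegral.norm_integral_le_of_norm_le hTt ?_ (by
            exact intervalIntegrable_const.add hind)
          exact ae_of_all _ fun t ht => hEQ t ((le_max_left _ _).trans ht.1.le)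
      _ = ε / 16 * (T - t₁) + 3 * volume.real (N ∩ Set.Ioc t₁ T) := by
          rw [intervalIntegral.integral_add intervalIntegrable_const hind,
            intervalIntegral.integral_const, intervalIntegral.integral_of_le hTt,
            setIntegral_indicator hN, setIntegral_const, Set.inter_comm]
          simp only [smul_eq_mul]
          ring
      _ ≤ _ := by
          have : volume.real (N ∩ Set.Ioc t₁ T) ≤ volume.real (N ∩ Set.Icc 0 T) :=
            measureReal_mono (Set.inter_subset_inter_right _ fun t ht =>
              ⟨ht₁0.trans ht.1.le, ht.2⟩) hfin
          have := hNd T hTpos.le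
          have : ε / 16 * (T - t₁) ≤ ε / 16 * T := by gcongr; linarith
          linarith
  have hnT : ‖(T : ℂ)⁻¹‖ = T⁻¹ := by
    rw [norm_inv, Complex.norm_real, Real.norm_of_nonneg hTpos.le]
  have c1 : ‖(T : ℂ)⁻¹ * ∫ t in (0 : ℝ)..t₁, E t - Q t‖ ≤ ε / 16 := by
    rw [norm_mul, hnT, inv_mul_le_iff₀ hTpos]
    refine b1.trans ?_
    calc (1 + C) * t₁ = (1 + C) * t₁ * (16 / ε) * (ε / 16) := by field_simp
      _ ≤ T * (ε / 16) := by gcongr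
  have c2 : ‖(T : ℂ)⁻¹ * ∫ t in t₁..T, E t - Q t‖ ≤ 7 / 16 * ε := by
    rw [norm_mul, hnT, inv_mul_le_iff₀ hTpos]
    refine b2.trans ?_
    nlinarith [mul_nonneg hε.le (sub_nonneg.mpr hT1)]
  rw [e1]
  have := norm_add_le ((T : ℂ)⁻¹ * (∫ t in (0 : ℝ)..T, Q t))
    ((T : ℂ)⁻¹ * (∫ t in (0 : ℝ)..t₁, E t - Q t) + (T : ℂ)⁻¹ * ∫ t in t₁..T, E t - Q t)
  have := norm_add_le ((T : ℂ)⁻¹ * (∫ t in (0 : ℝ)..t₁, E t - Q t))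
    ((T : ℂ)⁻¹ * ∫ t in t₁..T, E t - Q t)
  linarith

/-- A slowly varying perturbation of a character. -/
noncomputable def logPhase (ω κ t : ℝ) : ℂ := Complex.exp ((ω * t + κ * Real.log t : ℝ) * Complex.I)

theorem norm_logPhase (ω κ t : ℝ) : ‖logPhase ω κ t‖ = 1 := Complex.norm_exp_ofReal_mul_I _

theorem measurable_logPhase (ω κ : ℝ) : Measurable (logPhase ω κ) := by
  unfold logPhase; fun_prop

/-- Dividing by `iω` gives an antiderivative up to an error `O(1/t)` caused by the logarithm. The
integral is therefore `O(1 + log T)`; the interval `[0, 1]` is bounded trivially to avoid the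
singularity. -/
theorem averageTendstoZero_logPhase {ω : ℝ} (hω : ω ≠ 0) (κ : ℝ) :
    AverageTendstoZero (logPhase ω κ) := by
  have hω' : (ω : ℂ) ≠ 0 := by exact_mod_cast hω
  have hint : ∀ a b, IntervalIntegrable (logPhase ω κ) volume a b :=
    intervalIntegrable_of_bounded (measurable_logPhase ω κ) fun t => (norm_logPhase ω κ t).le
  have hd : ∀ t : ℝ, 0 < t → HasDerivAt (fun t => (ω * Complex.I)⁻¹ * logPhase ω κ t)
      (logPhase ω κ t + κ / ω * (logPhase ω κ t * ((t⁻¹ : ℝ) : ℂ))) t := by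
    intro t ht
    have h1 : HasDerivAt (fun t : ℝ => ω * t + κ * Real.log t) (ω * 1 + κ * t⁻¹) t :=
      ((hasDerivAt_id t).const_mul ω).add ((Real.hasDerivAt_log ht.ne').const_mul κ)
    refine (((h1.ofReal_comp.mul_const Complex.I).cexp).const_mul (ω * Complex.I)⁻¹).congr_deriv ?_
    rw [logPhase]
    have := Complex.I_ne_zero
    push_cast
    field_simp
  have hbound : ∀ T : ℝ, 1 ≤ T → ‖∫ t in (0 : ℝ)..T, logPhase ω κ t‖ ≤
      1 + 2 * |ω|⁻¹ + |κ| / |ω| * Real.log T := by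
    intro T hT
    have hcont : ContinuousOn (fun t : ℝ => logPhase ω κ t * ((t⁻¹ : ℝ) : ℂ)) (Set.uIcc 1 T) := by
      rw [Set.uIcc_of_le hT]
      intro t ht
      have ht0 : t ≠ 0 := by linarith [ht.1]
      have := Real.continuousAt_log ht0
      have := continuousAt_inv₀ ht0
      unfold logPhase
      exact ContinuousAt.continuousWithinAt (by fun_prop (disch := assumption))
    have h1 := intervalIntegral.integral_eq_sub_of_hasDerivAt (a := 1) (b := T)
      (fun t ht => hd t (by rw [Set.uIcc_of_le hT] at ht; linarith [ht.1]))
      ((hint 1 T).add (hcont.intervalIntegrable.const_mul _))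
    rw [intervalIntegral.integral_add (hint 1 T) (hcont.intervalIntegrable.const_mul _),
      intervalIntegral.integral_const_mul] at h1
    have h2 : ‖∫ t in (1 : ℝ)..T, logPhase ω κ t * ((t⁻¹ : ℝ) : ℂ)‖ ≤ Real.log T := by
      calc _ ≤ ∫ t in (1 : ℝ)..T, t⁻¹ := by
            refine intervalIntegral.norm_integral_le_of_norm_le hT ?_ ?_
            · refine ae_of_all _ fun t ht => ?_
              rw [norm_mul, norm_logPhase, one_mul, Complex.norm_real,
                Real.norm_of_nonneg (inv_nonneg.mpr (by linarith [ht.1]))]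
            · refine intervalIntegral.intervalIntegrable_inv (fun t ht => ?_) continuousOn_id
              rw [Set.uIcc_of_le hT] at ht
              linarith [ht.1]
        _ = Real.log T := by
            rw [integral_inv_of_pos one_pos (by linarith), div_one]
    have h3 : ∫ t in (1 : ℝ)..T, logPhase ω κ t = ((ω * Complex.I)⁻¹ * logPhase ω κ T -
        (ω * Complex.I)⁻¹ * logPhase ω κ 1) - κ / ω * ∫ t in (1 : ℝ)..T,
          logPhase ω κ t * ((t⁻¹ : ℝ) : ℂ) := by
      rw [← h1]; ring
    have h4 : ‖∫ t in (0 : ℝ)..1, logPhase ω κ t‖ ≤ 1 := by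
      refine (intervalIntegral.norm_integral_le_of_norm_le_const (C := 1) fun t _ =>
        (norm_logPhase ω κ t).le).trans_eq (by simp)
    rw [← intervalIntegral.integral_add_adjacent_intervals (hint 0 1) (hint 1 T), h3]
    have n1 : ∀ t, ‖(ω * Complex.I : ℂ)⁻¹ * logPhase ω κ t‖ = |ω|⁻¹ := fun t => by
      rw [norm_mul, norm_logPhase]; simp
    have n2 : ‖(κ / ω : ℂ) * ∫ t in (1 : ℝ)..T, logPhase ω κ t * ((t⁻¹ : ℝ) : ℂ)‖ ≤
        |κ| / |ω| * Real.log T := by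
      rw [norm_mul, norm_div, Complex.norm_real, Complex.norm_real]
      exact mul_le_mul_of_nonneg_left h2 (by positivity)
    refine (norm_add_le _ _).trans ?_
    have := norm_sub_le ((ω * Complex.I : ℂ)⁻¹ * logPhase ω κ T -
        (ω * Complex.I)⁻¹ * logPhase ω κ 1) ((κ / ω : ℂ) * ∫ t in (1 : ℝ)..T,
          logPhase ω κ t * ((t⁻¹ : ℝ) : ℂ))
    have := norm_sub_le ((ω * Complex.I : ℂ)⁻¹ * logPhase ω κ T)
      ((ω * Complex.I)⁻¹ * logPhase ω κ 1)
    rw [n1, n1] at this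
    linarith
  have hlim : Tendsto (fun T : ℝ => (1 + 2 * |ω|⁻¹) * T⁻¹ + |κ| / |ω| * (Real.log T / T)) atTop
      (𝓝 0) := by
    have h1 : Tendsto (fun T : ℝ => Real.log T / T) atTop (𝓝 0) := by
      simpa using Real.isLittleO_log_id_atTop.tendsto_div_nhds_zero
    simpa using (tendsto_inv_atTop_zero.const_mul (1 + 2 * |ω|⁻¹)).add (h1.const_mul (|κ| / |ω|))
  refine squeeze_zero_norm' ?_ hlim
  filter_upwards [eventually_ge_atTop 1] with T hT
  have hT0 : 0 < T := by linarith
  rw [norm_mul, norm_inv, Complex.norm_real, Real.norm_of_nonneg hT0.le]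
  calc _ ≤ T⁻¹ * (1 + 2 * |ω|⁻¹ + |κ| / |ω| * Real.log T) := by gcongr; exact hbound T hT
    _ = _ := by ring

/-! ### Algebras of trigonometric polynomials -/

/-- The functions `t ↦ e ^ (iνt)` with frequencies in an additive group of real numbers. -/
def characterSet (Λ : AddSubgroup ℝ) : Set (ℝ → ℂ) :=
  {q | ∃ ν ∈ Λ, q = fun t : ℝ => Complex.exp (ν * t * Complex.I)}

/-- The trigonometric polynomials with frequencies in an additive group of real numbers. -/
noncomputable def trigAlgebra (Λ : AddSubgroup ℝ) : Subalgebra ℂ (ℝ → ℂ) :=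
  Algebra.adjoin ℂ (characterSet Λ)

/-- Characters with frequencies in a group are closed under products, so their linear span is
already an algebra. Polynomials can then be taken inside it, while averages need checking only on
characters. -/
theorem trigAlgebra_toSubmodule (Λ : AddSubgroup ℝ) :
    Subalgebra.toSubmodule (trigAlgebra Λ) = Submodule.span ℂ (characterSet Λ) := by
  refine Algebra.adjoin_eq_span_of_subset _ ?_
  refine Set.Subset.trans ?_ Submodule.subset_span
  intro q hq
  refine Submonoid.closure_induction (fun _ => id) ⟨0, Λ.zero_mem, ?_⟩ ?_ hq
  · funext t; simp
  · rintro _ _ _ _ ⟨μ, hμ, rfl⟩ ⟨ν, hν, rfl⟩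
    refine ⟨μ + ν, Λ.add_mem hμ hν, ?_⟩
    funext t
    rw [Pi.mul_apply, ← Complex.exp_add]
    push_cast
    ring_nf

/-- Multiplication by a character with frequency in `Λ` shifts `ω` by an element of `Λ`, so the
resulting frequency is never zero. -/
theorem trigAlgebra_properties {Λ : AddSubgroup ℝ} {ω : ℝ} (hω : ω ∉ Λ) (κ : ℝ) {q : ℝ → ℂ}
    (hq : q ∈ trigAlgebra Λ) :
    Measurable q ∧ (∃ C, ∀ t, ‖q t‖ ≤ C) ∧ AverageTendstoZero fun t => logPhase ω κ t * q t := by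
  have hq' : q ∈ Submodule.span ℂ (characterSet Λ) := by
    rw [← trigAlgebra_toSubmodule]; exact hq
  clear hq
  induction hq' using Submodule.span_induction with
  | mem q hq =>
    obtain ⟨ν, hν, rfl⟩ := hq
    refine ⟨by fun_prop, ⟨1, fun t => (norm_exp_mul_I ν t).le⟩, ?_⟩
    have e : (fun t => logPhase ω κ t * Complex.exp (ν * t * Complex.I)) = logPhase (ω + ν) κ := by
      funext t
      rw [logPhase, logPhase, ← Complex.exp_add]
      push_cast
      ring_nf
    rw [e]
    refine averageTendstoZero_logPhase (fun h => hω ?_) κ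
    rw [eq_neg_of_add_eq_zero_left h]
    exact Λ.neg_mem hν
  | zero => exact ⟨measurable_const, ⟨0, by simp⟩, by simp [AverageTendstoZero]⟩
  | add x y _ _ hx hy =>
    obtain ⟨hxm, ⟨C, hC⟩, hx0⟩ := hx
    obtain ⟨hym, ⟨D, hD⟩, hy0⟩ := hy
    refine ⟨hxm.add hym, ⟨C + D, fun t => (norm_add_le _ _).trans (add_le_add (hC t) (hD t))⟩, ?_⟩
    have hi : ∀ (x : ℝ → ℂ) (C : ℝ), Measurable x → (∀ t, ‖x t‖ ≤ C) → ∀ a b,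
        IntervalIntegrable (fun t => logPhase ω κ t * x t) volume a b := fun x C hm hb =>
      intervalIntegrable_of_bounded ((measurable_logPhase ω κ).mul hm) fun t => by
        rw [norm_mul, norm_logPhase, one_mul]; exact hb t
    have := hx0.add hy0
    rw [add_zero] at this
    refine this.congr fun T => ?_
    rw [← mul_add, ← intervalIntegral.integral_add (hi x C hxm hC _ _) (hi y D hym hD _ _)]
    simp only [Pi.add_apply, mul_add]
  | smul c x _ hx =>
    obtain ⟨hxm, ⟨C, hC⟩, hx0⟩ := hx
    refine ⟨hxm.const_smul c, ⟨‖c‖ * C, fun t => ?_⟩, ?_⟩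
    · rw [Pi.smul_apply, norm_smul]
      exact mul_le_mul_of_nonneg_left (hC t) (norm_nonneg c)
    · have := hx0.const_mul c
      rw [mul_zero] at this
      refine this.congr fun T => ?_
      rw [mul_left_comm, ← intervalIntegral.integral_const_mul]
      simp only [Pi.smul_apply, smul_eq_mul, mul_left_comm]

theorem exists_complex_polynomial_near {K : ℝ → ℂ} (hK : Continuous K) (a b : ℝ) {δ : ℝ}
    (hδ : 0 < δ) : ∃ p : Polynomial ℂ, ∀ x ∈ Set.Icc a b, ‖p.eval (x : ℂ) - K x‖ < δ := by
  obtain ⟨p, hp⟩ := exists_polynomial_near_of_continuousOn a b (fun x => (K x).re)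
    (Complex.continuous_re.comp hK).continuousOn (δ / 2) (half_pos hδ)
  obtain ⟨q, hq⟩ := exists_polynomial_near_of_continuousOn a b (fun x => (K x).im)
    (Complex.continuous_im.comp hK).continuousOn (δ / 2) (half_pos hδ)
  refine ⟨p.map Complex.ofRealHom + Polynomial.C Complex.I * q.map Complex.ofRealHom,
    fun x hx => ?_⟩
  have hp' : (p.map Complex.ofRealHom).eval (x : ℂ) = (p.eval x : ℝ) := by
    rw [← Complex.ofRealHom_eq_coe, Polynomial.eval_map_apply]; rfl
  have hq' : (q.map Complex.ofRealHom).eval (x : ℂ) = (q.eval x : ℝ) := by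
    rw [← Complex.ofRealHom_eq_coe, Polynomial.eval_map_apply]; rfl
  rw [Polynomial.eval_add, Polynomial.eval_mul, Polynomial.eval_C, hp', hq']
  refine lt_of_le_of_lt (Complex.norm_le_abs_re_add_abs_im _) ?_
  have h1 := hp x hx
  have h2 := hq x hx
  have e1 : ((p.eval x : ℝ) + Complex.I * (q.eval x : ℝ) - K x : ℂ).re = p.eval x - (K x).re := by
    simp
  have e2 : ((p.eval x : ℝ) + Complex.I * (q.eval x : ℝ) - K x : ℂ).im = q.eval x - (K x).im := by
    simp
  rw [e1, e2]
  linarith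

section

variable {ι : Type*} [Fintype ι]

/-- The group generated by the differences of the given frequencies. -/
def differenceGroup (η : ι → ℝ) : AddSubgroup ℝ :=
  AddSubgroup.closure {x | ∃ i j, x = η i - η j}

/-- Expanding `g · conj g` leaves only differences of frequencies. This is why the nonresonance
condition involves differences. -/
theorem norm_sq_trigSum_mem (η : ι → ℝ) (c : ι → ℂ) :
    (fun t => ((‖trigSum η c t‖ ^ 2 : ℝ) : ℂ)) ∈ trigAlgebra (differenceGroup η) := by
  have e : (fun t => ((‖trigSum η c t‖ ^ 2 : ℝ) : ℂ)) = ∑ i, ∑ j,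
      (c i * (starRingEnd ℂ) (c j)) •
        fun t : ℝ => Complex.exp (((η i - η j : ℝ) : ℂ) * t * Complex.I) := by
    funext t
    simp only [Finset.sum_apply, Pi.smul_apply, smul_eq_mul]
    push_cast
    rw [← Complex.mul_conj', trigSum, map_sum, Finset.sum_mul_sum]
    refine Finset.sum_congr rfl fun i _ => Finset.sum_congr rfl fun j _ => ?_
    rw [map_mul, ← Complex.exp_conj, mul_mul_mul_comm, ← Complex.exp_add]
    congr 2
    simp
    ring
  rw [e]
  refine Subalgebra.sum_mem _ fun i _ => Subalgebra.sum_mem _ fun j _ => Subalgebra.smul_mem _ ?_ _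
  exact Algebra.subset_adjoin ⟨_, AddSubgroup.subset_closure ⟨i, j, rfl⟩, rfl⟩

theorem polynomial_norm_sq_trigSum_mem (η : ι → ℝ) (c : ι → ℂ) (p : Polynomial ℂ) :
    (fun t => p.eval ((‖trigSum η c t‖ ^ 2 : ℝ) : ℂ)) ∈ trigAlgebra (differenceGroup η) := by
  have h := Polynomial.aeval_mem_adjoin_singleton ℂ (p := p)
    (fun t => ((‖trigSum η c t‖ ^ 2 : ℝ) : ℂ))
  have h2 := Algebra.adjoin_le (Set.singleton_subset_iff.mpr (norm_sq_trigSum_mem η c)) h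
  convert h2 using 1
  funext t
  have := Polynomial.aeval_algHom_apply (Pi.evalAlgHom ℂ (fun _ : ℝ => ℂ) t)
    (fun t => ((‖trigSum η c t‖ ^ 2 : ℝ) : ℂ)) p
  rw [Polynomial.coe_aeval_eq_eval] at this
  exact this

theorem div_two_pi_mem_span_of_mem_differenceGroup {α : Type*} {η : α → ℝ} {ν : ℝ}
    (hν : ν ∈ differenceGroup η) :
    ν / (2 * π) ∈ Submodule.span ℚ {x | ∃ i j, x = (η i - η j) / (2 * π)} := by
  induction hν using AddSubgroup.closure_induction with
  | mem x hx =>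
    obtain ⟨i, j, rfl⟩ := hx
    exact Submodule.subset_span ⟨i, j, rfl⟩
  | zero => simp
  | add x y _ _ hx hy => rw [add_div]; exact Submodule.add_mem _ hx hy
  | neg x _ hx => rw [neg_div]; exact Submodule.neg_mem _ hx

/-! ### The Benford property from the dominant asymptotics -/

/-- A function which is asymptotically `e ^ (a t) t ^ k` times a nonzero trigonometric polynomial
is Benford if `a` is nonresonant with the differences of the frequencies. -/
theorem isBenfordFunction_of_asymptotic {b : ℕ} (hb : 2 ≤ b) {η : ι → ℝ}
    (hη : Function.Injective η) {c : ι → ℂ} (hc : c ≠ 0) {a : ℝ} (k : ℕ)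
    (hres : a / Real.log b ∉ Submodule.span ℚ {x | ∃ i j, x = (η i - η j) / (2 * π)})
    {f : ℝ → ℝ} (hf : Measurable f)
    (hlim : Tendsto (fun t : ℝ => ((Real.exp (-(a * t)) * (t ^ k)⁻¹ * f t : ℝ) : ℂ) - trigSum η c t)
      atTop (𝓝 0)) :
    IsBenfordFunction b f := by
  refine isBenfordFunction_of_tendsto_average_exp hb hf fun h hh => ?_
  have hb1 : (1 : ℝ) < b := by exact_mod_cast hb
  have hlog : 0 < Real.log b := Real.log_pos hb1
  have hh' : (h : ℝ) ≠ 0 := by exact_mod_cast hh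
  set g := trigSum η c with hg
  have hgc : Continuous g := continuous_trigSum η c
  set M := ∑ j, ‖c j‖ with hM
  have hgM : ∀ t, ‖g t‖ ≤ M := norm_trigSum_le η c
  have hM0 : 0 ≤ M := (norm_nonneg _).trans (hgM 0)
  -- The phase `2πh log_b |f|` is `ωt + κ log t` plus a term depending only on the normalized
  -- amplitude `A`.
  set ω := 2 * π * h * a / Real.log b with hω
  set κ := 2 * π * h * k / Real.log b with hκ
  have hωΛ : ω ∉ differenceGroup η := by
    intro hmem
    refine hres ?_
    have h1 := div_two_pi_mem_span_of_mem_differenceGroup hmem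
    have h2 : a / Real.log b = ((h : ℚ)⁻¹) • (ω / (2 * π)) := by
      rw [Rat.smul_def, hω]
      have := Real.pi_ne_zero
      push_cast
      field_simp
    rw [h2]
    exact Submodule.smul_mem _ _ h1
  set A : ℝ → ℝ := fun t => Real.exp (-(a * t)) * (t ^ k)⁻¹ * f t with hA
  -- Since `A` is real, `A²` is its squared modulus and so is asymptotic to `|g|²`, although `g`
  -- itself is only asymptotically real.
  set y : ℝ → ℝ := fun t => A t ^ 2 with hy
  have hylim : Tendsto (fun t => y t - ‖g t‖ ^ 2) atTop (𝓝 0) := by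
    have h1 : Tendsto (fun t => ‖(A t : ℂ)‖ - ‖g t‖) atTop (𝓝 0) :=
      squeeze_zero_norm (fun t => abs_norm_sub_norm_le _ _) (by simpa only [norm_zero] using hlim.norm)
    have h2 : Tendsto (fun t => (‖(A t : ℂ)‖ - ‖g t‖) ^ 2 +
        2 * ((‖(A t : ℂ)‖ - ‖g t‖) * ‖g t‖)) atTop (𝓝 (0 ^ 2 + 2 * 0)) := by
      refine (h1.pow 2).add (Tendsto.const_mul 2 ?_)
      have h3 := h1.norm.mul_const M
      rw [norm_zero, zero_mul] at h3
      refine squeeze_zero_norm (fun t => ?_) h3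
      rw [norm_mul, norm_norm]
      exact mul_le_mul_of_nonneg_left (hgM t) (norm_nonneg _)
    simp only [ne_eq, OfNat.ofNat_ne_zero, not_false_eq_true, zero_pow, mul_zero, add_zero] at h2
    refine h2.congr fun t => ?_
    simp only [hy]
    rw [Complex.norm_real, Real.norm_eq_abs, ← sq_abs (A t)]
    ring
  have hEeq : ∀ t, 0 < t → y t ≠ 0 →
      Complex.exp (2 * π * Complex.I * h * (Real.logb b |f t| : ℝ)) = logPhase ω κ t *
        Complex.exp ((π * h * Real.log (y t) / Real.log b : ℝ) * Complex.I) := by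
    intro t ht hyt
    have htk : (t ^ k)⁻¹ ≠ 0 := by positivity
    have hft : f t ≠ 0 := by
      intro h0
      exact hyt (by simp [hy, hA, h0])
    rw [logPhase, ← Complex.exp_add, ← add_mul, ← Complex.ofReal_add]
    have e1 : Real.log (y t) = 2 * (-(a * t) - k * Real.log t + Real.log |f t|) := by
      simp only [hy, hA]
      rw [Real.log_pow, Real.log_mul (mul_ne_zero (Real.exp_pos _).ne' htk) hft,
        Real.log_mul (Real.exp_pos _).ne' htk, Real.log_exp, Real.log_inv, Real.log_pow,
        Real.log_abs]
      push_cast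
      ring
    rw [e1, hω, hκ, Real.logb]
    congr 1
    push_cast
    have : (Real.log b : ℂ) ≠ 0 := by exact_mod_cast hlog.ne'
    field_simp
    ring
  have hvm := measurable_logb_abs hf b
  refine averageTendstoZero_of_approx (by fun_prop) (fun t => (norm_exp_two_pi_int h _).le) ?_
  intro δ' hδ'
  -- Two errors of size `δ` arise, from uniform continuity and from polynomial approximation; `δ ≤
  -- 1` keeps the error on the exceptional set within the allowed `3`.
  obtain ⟨δ, hδ, hδ1, hδ2⟩ : ∃ δ, 0 < δ ∧ δ ≤ 1 ∧ 2 * δ ≤ δ' :=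
    ⟨min 1 (δ' / 2), by positivity, min_le_left _ _, by linarith [min_le_right 1 (δ' / 2)]⟩
  obtain ⟨ε₁, hε₁, hdens⟩ := exists_density_trigSum_small hη hc hδ
  -- Off the exceptional set `|g|² ≥ 2ε`. Once `y` is within `ε` of `|g|²` it is at least `ε`, so
  -- the cutoff `max x ε` in `K` has no effect there.
  set ε := ε₁ ^ 2 / 2 with hε
  have hε0 : 0 < ε := by positivity
  set K : ℝ → ℂ := fun x => Complex.exp ((π * h * Real.log (max x ε) / Real.log b : ℝ) * Complex.I)
    with hK
  have hKc : Continuous K := by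
    have : Continuous fun x : ℝ => Real.log (max x ε) :=
      Continuous.log (by fun_prop) fun x => (lt_max_of_lt_right hε0).ne'
    fun_prop
  have hK1 : ∀ x, ‖K x‖ = 1 := fun x => Complex.norm_exp_ofReal_mul_I _
  obtain ⟨p, hp⟩ := exists_complex_polynomial_near hKc 0 (M ^ 2) hδ
  have hg2 : ∀ t, ‖g t‖ ^ 2 ∈ Set.Icc 0 (M ^ 2) := fun t =>
    ⟨by positivity, pow_le_pow_left₀ (norm_nonneg _) (hgM t) 2⟩
  obtain ⟨hqm, ⟨C, hC⟩, hq0⟩ := trigAlgebra_properties hωΛ κ (polynomial_norm_sq_trigSum_mem η c p)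
  have hunif := (isCompact_Icc (a := (-1 : ℝ)) (b := M ^ 2 + 1)).uniformContinuousOn_of_continuous
    hKc.continuousOn
  obtain ⟨ρ, hρ, hρK⟩ := Metric.uniformContinuousOn_iff.mp hunif δ hδ
  obtain ⟨t₀, ht₀⟩ := (Metric.tendsto_atTop.mp hylim) (min ε (min ρ 1)) (by positivity)
  refine ⟨fun t => logPhase ω κ t * p.eval ((‖g t‖ ^ 2 : ℝ) : ℂ), {t | ‖g t‖ < ε₁}, C, max t₀ 1, (measurable_logPhase ω κ).mul hqm, fun t => ?_, hq0,
    measurableSet_lt hgc.norm.measurable measurable_const, fun T hT => ?_, fun t ht => ?_⟩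
  · rw [norm_mul, norm_logPhase, one_mul]; exact hC t
  · rw [Set.inter_comm]
    refine (hdens T hT).trans ?_
    gcongr
    linarith
  · have htt : t₀ ≤ t := (le_max_left _ _).trans ht
    have ht1 : 0 < t := lt_of_lt_of_le one_pos ((le_max_right _ _).trans ht)
    have hyt := ht₀ t htt
    rw [dist_zero_right, Real.norm_eq_abs] at hyt
    have hy1 : |y t - ‖g t‖ ^ 2| < ε := hyt.trans_le (min_le_left _ _)
    have hy2 : |y t - ‖g t‖ ^ 2| < ρ := hyt.trans_le ((min_le_right _ _).trans (min_le_left _ _))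
    have hy3 : |y t - ‖g t‖ ^ 2| < 1 := hyt.trans_le ((min_le_right _ _).trans (min_le_right _ _))
    have hpt := hp _ (hg2 t)
    by_cases hN : ‖g t‖ < ε₁
    · rw [Set.indicator_of_mem (by exact hN)]
      refine (norm_sub_le _ _).trans ?_
      rw [norm_exp_two_pi_int, norm_mul, norm_logPhase, one_mul]
      have := norm_sub_norm_le (p.eval ((‖g t‖ ^ 2 : ℝ) : ℂ)) (K (‖g t‖ ^ 2))
      rw [hK1] at this
      linarith
    · rw [Set.indicator_of_notMem (by exact hN), add_zero]
      have h1 : 2 * ε ≤ ‖g t‖ ^ 2 := by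
        rw [hε]
        have := pow_le_pow_left₀ hε₁.le (not_lt.mp hN) 2
        linarith
      have h2 : ε ≤ y t := by
        have := (abs_lt.mp hy1).1
        linarith
      rw [hEeq t ht1 (by linarith)]
      have h3 : Complex.exp ((π * h * Real.log (y t) / Real.log b : ℝ) * Complex.I) = K (y t) := by
        simp only [hK, max_eq_left h2]
      rw [h3, ← mul_sub, norm_mul, norm_logPhase, one_mul]
      have h4 : dist (K (y t)) (K (‖g t‖ ^ 2)) < δ := by
        refine hρK _ ⟨by linarith, ?_⟩ _ ⟨by linarith [(hg2 t).1], by linarith [(hg2 t).2]⟩ ?_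
        · linarith [(abs_lt.mp hy3).2, (hg2 t).2]
        · rwa [Real.dist_eq]
      rw [dist_eq_norm] at h4
      have e : K (y t) - p.eval ((‖g t‖ ^ 2 : ℝ) : ℂ) = (K (y t) - K (‖g t‖ ^ 2)) -
        (p.eval ((‖g t‖ ^ 2 : ℝ) : ℂ) - K (‖g t‖ ^ 2)) := by ring
      rw [e]
      refine (norm_sub_le _ _).trans ?_
      linarith

end

theorem tendsto_exp_neg_mul_polynomial {c : ℝ} (hc : 0 < c) (p : Polynomial ℂ) :
    Tendsto (fun t : ℝ => (Real.exp (-(c * t)) : ℂ) * p.eval (t : ℂ)) atTop (𝓝 0) := by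
  simp_rw [Polynomial.eval_eq_sum_range, Finset.mul_sum]
  rw [show (0 : ℂ) = ∑ i ∈ Finset.range (p.natDegree + 1), p.coeff i * ((0 : ℝ) : ℂ) by simp]
  refine tendsto_finsetSum _ fun i _ => ?_
  have h := tendsto_rpow_mul_exp_neg_mul_atTop_nhds_zero i c hc
  have h2 := ((Complex.continuous_ofReal.tendsto 0).comp h).const_mul (p.coeff i)
  refine h2.congr fun t => ?_
  simp only [Function.comp, Real.rpow_natCast, neg_mul]
  push_cast
  ring

theorem tendsto_inv_pow_mul_polynomial {k : ℕ} {p : Polynomial ℂ} (hp : p.natDegree ≤ k) :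
    Tendsto (fun t : ℝ => ((t : ℂ) ^ k)⁻¹ * p.eval (t : ℂ)) atTop (𝓝 (p.coeff k)) := by
  simp_rw [Polynomial.eval_eq_sum_range' (Nat.lt_succ_of_le hp), Finset.mul_sum]
  rw [show p.coeff k = ∑ i ∈ Finset.range (k + 1), if i = k then p.coeff k else 0 by simp]
  refine tendsto_finsetSum _ fun i hi => ?_
  have hik : i ≤ k := Nat.lt_succ_iff.mp (Finset.mem_range.mp hi)
  split_ifs with h
  · subst h
    refine tendsto_const_nhds.congr' ?_
    filter_upwards [eventually_gt_atTop 0] with t ht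
    have : (t : ℂ) ≠ 0 := by exact_mod_cast ht.ne'
    field_simp
  · have h1 : Tendsto (fun t : ℝ => (t ^ (k - i))⁻¹) atTop (𝓝 0) :=
      tendsto_inv_atTop_zero.comp (tendsto_pow_atTop (by omega))
    have h2 := ((Complex.continuous_ofReal.tendsto 0).comp h1).const_mul (p.coeff i)
    rw [Complex.ofReal_zero, mul_zero] at h2
    refine h2.congr' ?_
    filter_upwards [eventually_gt_atTop 0] with t ht
    have : (t : ℂ) ≠ 0 := by exact_mod_cast ht.ne'
    simp only [Function.comp]
    push_cast
    rw [show (t : ℂ) ^ k = t ^ (k - i) * t ^ i by rw [← pow_add, Nat.sub_add_cancel hik]]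
    field_simp

/-- A nonzero real exponential polynomial is Benford, if its exponents are nonresonant. -/
theorem IsExpPolynomial.isBenfordFunction {b : ℕ} (hb : 2 ≤ b) {S : Finset ℂ}
    (hS : ∀ z ∈ S, z.re / Real.log b ∉ Submodule.span ℚ
      {x | ∃ w ∈ S, ∃ w' ∈ S, w.re = z.re ∧ w'.re = z.re ∧ x = (w.im - w'.im) / (2 * π)})
    {f : ℝ → ℝ} (hfm : Measurable f) (hf : IsExpPolynomial S fun t => (f t : ℂ))
    (hf0 : ∃ t, f t ≠ 0) : IsBenfordFunction b f := by
  classical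
  obtain ⟨P, hP : ∀ t : ℝ, (f t : ℂ) = _⟩ := hf
  set S₁ := S.filter fun w => P w ≠ 0 with hS₁
  have hsum : ∀ t : ℝ, (f t : ℂ) = ∑ w ∈ S₁, Complex.exp (w * t) * (P w).eval (t : ℂ) := by
    intro t
    rw [hP, hS₁, Finset.sum_filter]
    refine Finset.sum_congr rfl fun w _ => ?_
    split_ifs with h
    · rfl
    · rw [not_not] at h
      simp [h]
  have hne : S₁.Nonempty := by
    rw [Finset.nonempty_iff_ne_empty]
    intro h
    obtain ⟨t, ht⟩ := hf0
    have := hsum t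
    rw [h, Finset.sum_empty] at this
    exact ht (by exact_mod_cast this)
  -- The dominant scale `e^(at) t^k` takes the largest real part, then the largest degree among the
  -- terms attaining it. The coefficients of `t^k` in these terms form a trigonometric polynomial;
  -- it is nonzero because some term has degree exactly `k`.
  obtain ⟨z, hz, hzmax⟩ := S₁.exists_max_image Complex.re hne
  set a := z.re with ha
  set S₂ := S₁.filter fun w => w.re = a with hS₂
  have hzS₂ : z ∈ S₂ := Finset.mem_filter.mpr ⟨hz, rfl⟩
  obtain ⟨z', hz', hkmax⟩ := S₂.exists_max_image (fun w => (P w).natDegree) ⟨z, hzS₂⟩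
  set k := (P z').natDegree with hk
  have hS₂S : ∀ w ∈ S₂, w ∈ S := fun w hw => (Finset.mem_filter.mp (Finset.mem_filter.mp hw).1).1
  have hre : ∀ w ∈ S₂, w.re = a := fun w hw => (Finset.mem_filter.mp hw).2
  set η : S₂ → ℝ := fun w => (w : ℂ).im with hη
  set c : S₂ → ℂ := fun w => (P w).coeff k with hc
  have hηinj : Function.Injective η := by
    intro w w' h
    exact Subtype.ext (Complex.ext ((hre w w.2).trans (hre w' w'.2).symm) h)
  have hc0 : c ≠ 0 := by
    intro h
    have h1 : (P z').coeff (P z').natDegree = 0 := congrFun h ⟨z', hz'⟩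
    have h2 : P z' ≠ 0 := (Finset.mem_filter.mp (Finset.mem_filter.mp hz').1).2
    exact h2 (Polynomial.leadingCoeff_eq_zero.mp h1)
  refine isBenfordFunction_of_asymptotic hb hηinj hc0 (a := a) k ?_ hfm ?_
  · intro hmem
    refine hS z (hS₂S z hzS₂) (Submodule.span_mono ?_ hmem)
    rintro x ⟨i, j, rfl⟩
    exact ⟨i, hS₂S i i.2, j, hS₂S j j.2, hre i i.2, hre j j.2, rfl⟩
  · have hterm : ∀ w ∈ S₁, Tendsto (fun t : ℝ => (Real.exp (-(a * t)) : ℂ) * ((t : ℂ) ^ k)⁻¹ *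
        (Complex.exp (w * t) * (P w).eval (t : ℂ)) -
          if w ∈ S₂ then (P w).coeff k * Complex.exp (w.im * t * Complex.I) else 0)
        atTop (𝓝 0) := by
      intro w hw
      have hexp : ∀ t : ℝ, Complex.exp (w * t) =
          (Real.exp (w.re * t) : ℂ) * Complex.exp (w.im * t * Complex.I) := by
        intro t
        rw [Complex.ofReal_exp, ← Complex.exp_add]
        congr 1
        conv_lhs => rw [← Complex.re_add_im w]
        push_cast
        ring
      split_ifs with h2
      · have h3 := tendsto_inv_pow_mul_polynomial (hkmax w h2)
        have h4 := (tendsto_sub_nhds_zero_iff.mpr h3).norm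
        rw [norm_zero] at h4
        refine squeeze_zero_norm (fun t => le_of_eq ?_) h4
        have e : (Real.exp (-(a * t)) : ℂ) * (Real.exp (w.re * t) : ℂ) = 1 := by
          rw [← Complex.ofReal_mul, ← Real.exp_add, hre w h2]
          simp
        rw [hexp]
        have e2 : (Real.exp (-(a * t)) : ℂ) * ((t : ℂ) ^ k)⁻¹ *
            ((Real.exp (w.re * t) : ℂ) * Complex.exp (w.im * t * Complex.I) *
              (P w).eval (t : ℂ)) - (P w).coeff k * Complex.exp (w.im * t * Complex.I) =
            Complex.exp (w.im * t * Complex.I) *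
              (((t : ℂ) ^ k)⁻¹ * (P w).eval (t : ℂ) - (P w).coeff k) := by
          linear_combination (((t : ℂ) ^ k)⁻¹ * Complex.exp (w.im * t * Complex.I) *
            (P w).eval (t : ℂ)) * e
        rw [e2, norm_mul, norm_exp_mul_I, one_mul]
      · have hlt : w.re < a := lt_of_le_of_ne (hzmax w hw) fun h =>
          h2 (Finset.mem_filter.mpr ⟨hw, h⟩)
        have h3 := (tendsto_exp_neg_mul_polynomial (sub_pos.mpr hlt) (P w)).norm
        rw [norm_zero] at h3
        refine squeeze_zero_norm' ?_ h3
        filter_upwards [eventually_ge_atTop 1] with t ht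
        have e : (Real.exp (-(a * t)) : ℂ) * (Real.exp (w.re * t) : ℂ) =
            (Real.exp (-((a - w.re) * t)) : ℂ) := by
          rw [← Complex.ofReal_mul, ← Real.exp_add]
          congr 2
          ring
        rw [hexp, sub_zero]
        have e2 : (Real.exp (-(a * t)) : ℂ) * ((t : ℂ) ^ k)⁻¹ *
            ((Real.exp (w.re * t) : ℂ) * Complex.exp (w.im * t * Complex.I) *
              (P w).eval (t : ℂ)) = (((t : ℂ) ^ k)⁻¹ * Complex.exp (w.im * t * Complex.I)) *
              ((Real.exp (-((a - w.re) * t)) : ℂ) * (P w).eval (t : ℂ)) := by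
          rw [← e]; ring
        rw [e2, norm_mul, norm_mul, norm_exp_mul_I, mul_one, norm_inv, norm_pow, Complex.norm_real,
          Real.norm_of_nonneg (by linarith)]
        exact mul_le_of_le_one_left (norm_nonneg _) (inv_le_one_of_one_le₀ (one_le_pow₀ ht))
    have hall := tendsto_finsetSum S₁ hterm
    rw [Finset.sum_const_zero] at hall
    refine hall.congr fun t => ?_
    rw [Finset.sum_sub_distrib, ← Finset.mul_sum, ← hsum]
    congr 1
    · push_cast
      ring
    · rw [← Finset.sum_filter]
      have : S₁.filter (fun w => w ∈ S₂) = S₂ := by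
        ext w
        simp only [hS₂, Finset.mem_filter]
        tauto
      rw [this, trigSum, ← Finset.sum_coe_sort]

/-! ### Nonresonance in terms of real and imaginary parts -/

/-- The differences, in units of `2π`, of imaginary parts of elements of `Z` with real part `a`. -/
def imDifferences (Z : Set ℂ) (a : ℝ) : Set ℝ :=
  {x | ∃ w ∈ Z, ∃ w' ∈ Z, w.re = a ∧ w'.re = a ∧ x = (w.im - w'.im) / (2 * π)}

theorem Set.Finite.imDifferences {Z : Set ℂ} (hZ : Z.Finite) (a : ℝ) :
    (imDifferences Z a).Finite := by
  refine (hZ.image2 (fun w w' => (w.im - w'.im) / (2 * π)) hZ).subset ?_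
  rintro x ⟨w, hw, w', hw', -, -, rfl⟩
  exact ⟨w, hw, w', hw', rfl⟩

theorem exists_arg_exp_eq (z : ℂ) : ∃ n : ℤ, (Complex.exp z).arg = z.im - 2 * π * n := by
  refine ⟨toIocDiv Real.two_pi_pos (-π) z.im, ?_⟩
  rw [Complex.arg_exp, toIocMod, zsmul_eq_mul]
  ring

theorem norm_exp_ofReal_mul (t : ℝ) (z : ℂ) : ‖Complex.exp (t * z)‖ = Real.exp (t * z.re) := by
  rw [Complex.norm_exp, Complex.re_ofReal_mul]

theorem exists_arg_exp_sub_arg_exp_eq (t : ℝ) (w w' : ℂ) :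
    ∃ n : ℤ, ((Complex.exp (t * w)).arg - (Complex.exp (t * w')).arg) / (2 * π) =
      t * ((w.im - w'.im) / (2 * π)) + n := by
  obtain ⟨m, hm⟩ := exists_arg_exp_eq (t * w)
  obtain ⟨m', hm'⟩ := exists_arg_exp_eq (t * w')
  refine ⟨m' - m, ?_⟩
  rw [hm, hm', Complex.im_ofReal_mul, Complex.im_ofReal_mul]
  have := Real.pi_ne_zero
  push_cast
  field_simp
  ring

theorem logb_norm_exp (b : ℕ) (t : ℝ) (z : ℂ) :
    Real.logb b (Real.exp (t * z.re)) = t * (z.re / Real.log b) := by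
  rw [Real.logb, Real.log_exp, mul_div_assoc]

/-- Multiplying a rational relation by `t` turns it into one among arguments up to integers, and `1
∈ Δ_Z` absorbs the integers. This works for any witness `t`. -/
theorem IsExpNonresonant.notMem_span {b : ℕ} {Z : Set ℂ} (h : IsExpNonresonant b Z) {z : ℂ}
    (hz : z ∈ Z) : z.re / Real.log b ∉ Submodule.span ℚ (imDifferences Z z.re) := by
  intro hmem
  obtain ⟨t, -, ht⟩ := h
  set Z' := (fun z : ℂ => Complex.exp (t * z)) '' Z ∩
    Metric.sphere (0 : ℂ) (Real.exp (t * z.re)) with hZ'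
  have hmemZ' : ∀ w ∈ Z, w.re = z.re → Complex.exp (t * w) ∈ Z' := by
    intro w hw hre
    refine ⟨⟨w, hw, rfl⟩, ?_⟩
    rw [mem_sphere_zero_iff_norm, norm_exp_ofReal_mul, hre]
  rcases ht (Real.exp (t * z.re)) (Real.exp_pos _) with ⟨-, -, -, h2⟩ | h2
  · refine h2 ?_
    rw [logb_norm_exp]
    have hone : (1 : ℝ) ∈ Submodule.span ℚ (argDifferences Z') :=
      Submodule.subset_span ⟨_, hmemZ' z hz rfl, _, hmemZ' z hz rfl, by simp⟩
    have hint : ∀ n : ℤ, (n : ℝ) ∈ Submodule.span ℚ (argDifferences Z') := by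
      intro n
      have := Submodule.smul_mem _ (n : ℚ) hone
      rwa [Rat.smul_def, mul_one, Rat.cast_intCast] at this
    generalize z.re / Real.log b = y at hmem
    induction hmem using Submodule.span_induction with
    | mem x hx =>
      obtain ⟨w, hw, w', hw', hre, hre', rfl⟩ := hx
      obtain ⟨n, hn⟩ := exists_arg_exp_sub_arg_exp_eq t w w'
      have h3 : 1 + (t * ((w.im - w'.im) / (2 * π)) + n) ∈
          Submodule.span ℚ (argDifferences Z') :=
        Submodule.subset_span ⟨_, hmemZ' w hw hre, _, hmemZ' w' hw' hre', by rw [hn]⟩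
      have h4 := Submodule.sub_mem _ h3 (hint (n + 1))
      convert h4 using 1
      push_cast
      ring
    | zero => simp
    | add x y _ _ hx hy => rw [mul_add]; exact Submodule.add_mem _ hx hy
    | smul q x _ hx => rw [mul_smul_comm]; exact Submodule.smul_mem _ _ hx
  · exact Set.eq_empty_iff_forall_notMem.mp h2 _ (hmemZ' z hz rfl)

/-- Each forbidden equation determines `t`. There are only countably many, since the spectrum is
finite and a finite-dimensional rational span is countable, so some positive time avoids them all.
-/
theorem exists_pos_time_notMem {b : ℕ} {Z : Set ℂ} (hZ : Z.Finite) :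
    ∃ t : ℝ, 0 < t ∧
      (∀ w ∈ Z, ∀ w' ∈ Z, w.im ≠ w'.im → ∀ q : ℚ, t * ((w.im - w'.im) / (2 * π)) ≠ q) ∧
      ∀ z ∈ Z, z.re / Real.log b ∉ Submodule.span ℚ (imDifferences Z z.re) →
        ∀ q : ℚ, ∀ s ∈ Submodule.span ℚ (imDifferences Z z.re),
          t * (z.re / Real.log b) ≠ q + t * s := by
  have h1 : (⋃ w ∈ Z, ⋃ w' ∈ Z,
      Set.range fun q : ℚ => (q : ℝ) / ((w.im - w'.im) / (2 * π))).Countable :=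
    hZ.countable.biUnion fun w _ => hZ.countable.biUnion fun w' _ => Set.countable_range _
  have h2 : (⋃ z ∈ Z, Set.image2 (fun (q : ℚ) (s : ℝ) => (q : ℝ) / (z.re / Real.log b - s)) Set.univ
      (Submodule.span ℚ (imDifferences Z z.re) : Set ℝ)).Countable := by
    refine hZ.countable.biUnion fun z _ => Set.countable_univ.image2 ?_ _
    have : Module.Finite ℚ (Submodule.span ℚ (imDifferences Z z.re)) :=
      Module.Finite.span_of_finite ℚ (hZ.imDifferences z.re)
    have : Countable (Submodule.span ℚ (imDifferences Z z.re)) :=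
      Finsupp.Countable.of_moduleFinite (R := ℚ)
    exact Set.countable_coe_iff.mp this
  obtain ⟨t, ht0, ht⟩ := ((h1.union h2).dense_compl ℝ).inter_open_nonempty _ isOpen_Ioi
    (Set.nonempty_Ioi (a := (0 : ℝ)))
  refine ⟨t, ht0, ?_, ?_⟩
  · intro w hw w' hw' hne q hq
    refine ht (Or.inl ?_)
    simp only [Set.mem_iUnion]
    refine ⟨w, hw, w', hw', q, ?_⟩
    have : (w.im - w'.im) / (2 * π) ≠ 0 :=
      div_ne_zero (sub_ne_zero.mpr hne) Real.two_pi_pos.ne'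
    simp only
    rw [← hq, mul_div_cancel_right₀ _ this]
  · intro z hz hres q s hs hq
    refine ht (Or.inr ?_)
    simp only [Set.mem_iUnion]
    refine ⟨z, hz, q, Set.mem_univ _, s, hs, ?_⟩
    have : z.re / Real.log b - s ≠ 0 := by
      intro h0
      rw [sub_eq_zero] at h0
      exact hres (h0 ▸ hs)
    simp only
    rw [div_eq_iff this]
    linarith

/-- Exponential nonresonance of a finite set in terms of real and imaginary parts. -/
theorem isExpNonresonant_iff {b : ℕ} {Z : Set ℂ} (hZ : Z.Finite) :
    IsExpNonresonant b Z ↔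
      ∀ z ∈ Z, z.re / Real.log b ∉ Submodule.span ℚ (imDifferences Z z.re) := by
  refine ⟨fun h z hz => h.notMem_span hz, fun h => ?_⟩
  obtain ⟨t, ht0, ht1, ht2⟩ := exists_pos_time_notMem (b := b) hZ
  refine ⟨t, ht0.le, fun r hr => ?_⟩
  rcases Set.eq_empty_or_nonempty ((fun z : ℂ => Complex.exp (t * z)) '' Z ∩
    Metric.sphere (0 : ℂ) r) with he | hne
  · exact Or.inr he
  obtain ⟨_, ⟨z, hz, rfl⟩, hzr⟩ := id hne
  rw [mem_sphere_zero_iff_norm, norm_exp_ofReal_mul] at hzr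
  have hre : ∀ w : ℂ, Complex.exp (t * w) ∈ Metric.sphere (0 : ℂ) r → w.re = z.re := by
    intro w hw
    rw [mem_sphere_zero_iff_norm, norm_exp_ofReal_mul, ← hzr] at hw
    exact mul_left_cancel₀ ht0.ne' (Real.exp_injective hw)
  refine Or.inl ⟨hne, Set.inter_subset_right, ?_, ?_⟩
  · ext x
    rw [Set.mem_singleton_iff]
    constructor
    · rintro ⟨⟨_, ⟨⟨w, hw, rfl⟩, hwr⟩, _, ⟨⟨w', hw', rfl⟩, hwr'⟩, rfl⟩, q, hq⟩
      by_cases him : w.im = w'.im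
      · rw [Complex.ext ((hre w hwr).trans (hre w' hwr').symm) him]
        simp
      · obtain ⟨n, hn⟩ := exists_arg_exp_sub_arg_exp_eq t w w'
        refine absurd ?_ (ht1 w hw w' hw' him (q - 1 - n))
        rw [hn] at hq
        push_cast
        linarith
    · rintro rfl
      obtain ⟨u, hu⟩ := hne
      exact ⟨⟨u, hu, u, hu, by simp⟩, 1, by simp⟩
  · rw [← hzr, logb_norm_exp]
    intro hmem
    -- Elements of `Δ_Z` are rational shifts of `t` times imaginary differences, and this form is
    -- stable under rational combinations. The choice of `t` excludes it for `log_b r`.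
    have hspan : ∀ x ∈ Submodule.span ℚ (argDifferences ((fun z : ℂ => Complex.exp (t * z)) '' Z ∩
        Metric.sphere (0 : ℂ) (Real.exp (t * z.re)))),
        ∃ q : ℚ, ∃ s ∈ Submodule.span ℚ (imDifferences Z z.re), x = q + t * s := by
      intro x hx
      induction hx using Submodule.span_induction with
      | mem x hx =>
        rw [hzr] at hx
        obtain ⟨_, ⟨⟨w, hw, rfl⟩, hwr⟩, _, ⟨⟨w', hw', rfl⟩, hwr'⟩, rfl⟩ := hx
        obtain ⟨n, hn⟩ := exists_arg_exp_sub_arg_exp_eq t w w'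
        refine ⟨1 + n, _, Submodule.subset_span ⟨w, hw, w', hw', hre w hwr, hre w' hwr', rfl⟩, ?_⟩
        rw [hn]
        push_cast
        ring
      | zero => exact ⟨0, 0, Submodule.zero_mem _, by simp⟩
      | add x y _ _ hx hy =>
        obtain ⟨q, s, hs, rfl⟩ := hx
        obtain ⟨q', s', hs', rfl⟩ := hy
        exact ⟨q + q', s + s', Submodule.add_mem _ hs hs', by push_cast; ring⟩
      | smul c x _ hx =>
        obtain ⟨q, s, hs, rfl⟩ := hx
        refine ⟨c * q, c • s, Submodule.smul_mem _ _ hs, ?_⟩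
        rw [Rat.smul_def, Rat.smul_def]
        push_cast
        ring
    obtain ⟨q, s, hs, hq⟩ := hspan _ hmem
    exact ht2 z hz (h z hz) q s hs hq

/-! ### From a rational relation to a functional that is not Benford -/

theorem exists_int_combination_of_mem_span {ι : Type*} [Fintype ι] {η : ι → ℝ} {x : ℝ}
    (hx : x ∈ Submodule.span ℚ {x | ∃ i j, x = (η i - η j) / (2 * π)}) :
    ∃ M : ℤ, M ≠ 0 ∧ ∃ p : ι → ℤ, 2 * π * M * x = ∑ j, p j * η j := by
  classical
  induction hx using Submodule.span_induction with
  | mem x hx =>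
    obtain ⟨i, j, rfl⟩ := hx
    refine ⟨1, one_ne_zero, Pi.single i 1 - Pi.single j 1, ?_⟩
    have := Real.pi_ne_zero
    simp only [Pi.sub_apply, Pi.single_apply]
    push_cast
    simp only [sub_mul, Finset.sum_sub_distrib, ite_mul, one_mul, zero_mul, Finset.sum_ite_eq',
      Finset.mem_univ, if_true]
    field_simp
  | zero => exact ⟨1, one_ne_zero, 0, by simp⟩
  | add x y _ _ hx hy =>
    obtain ⟨M, hM, p, hp⟩ := hx
    obtain ⟨M', hM', p', hp'⟩ := hy
    refine ⟨M * M', mul_ne_zero hM hM', fun j => M' * p j + M * p' j, ?_⟩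
    push_cast
    simp_rw [add_mul, mul_assoc, Finset.sum_add_distrib, ← Finset.mul_sum]
    rw [← hp, ← hp']
    ring
  | smul q x _ hx =>
    obtain ⟨M, hM, p, hp⟩ := hx
    refine ⟨q.den * M, mul_ne_zero (by exact_mod_cast q.den_ne_zero) hM, fun j => q.num * p j, ?_⟩
    push_cast
    simp_rw [mul_assoc, ← Finset.mul_sum]
    rw [← hp, Rat.smul_def]
    have h : (q.den : ℝ) * (q : ℝ) = q.num := by exact_mod_cast Rat.den_mul_eq_num q
    rw [← h]
    ring

namespace LinearFlow

variable {X : Type*} [NormedAddCommGroup X] [NormedSpace ℝ X] [FiniteDimensional ℝ X]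
  (φ : LinearFlow X)

theorem isBenfordFunction_functional {b : ℕ} (hb : 2 ≤ b)
    (h : ∀ z ∈ φ.spectrum, z.re / Real.log b ∉ Submodule.span ℚ (imDifferences φ.spectrum z.re))
    (H : (X →L[ℝ] X) →ₗ[ℝ] ℝ) (hH : ∃ t, H (φ.timeMap t) ≠ 0) :
    IsBenfordFunction b fun t => H (φ.timeMap t) := by
  refine IsExpPolynomial.isBenfordFunction hb ?_ (φ.measurable_functional H)
    (φ.isExpPolynomial_functional H) hH
  simpa only [Set.Finite.mem_toFinset, imDifferences] using h

/-- Conjugating inside the real part reverses the frequency, so either sign is realized by the same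
eigenvalue with a conjugated coefficient. -/
theorem exists_functional_eq_sum {ι : Type*} [Fintype ι] {w : ι → ℂ}
    (hw : ∀ j, w j ∈ φ.spectrum) {a : ℝ} (ha : ∀ j, (w j).re = a) {η : ι → ℝ}
    (hη : ∀ j, η j = (w j).im ∨ η j = -(w j).im) (z : ι → ℂ) :
    ∃ H : (X →L[ℝ] X) →ₗ[ℝ] ℝ, ∀ t : ℝ, H (φ.timeMap t) =
      Real.exp (a * t) * (∑ j, z j * Complex.exp (η j * t * Complex.I)).re := by
  have hterm : ∀ j, ∃ H : (X →L[ℝ] X) →ₗ[ℝ] ℝ, ∀ t : ℝ, H (φ.timeMap t) =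
      Real.exp (a * t) * (z j * Complex.exp (η j * t * Complex.I)).re := by
    intro j
    rcases hη j with h | h
    · obtain ⟨H, hH⟩ := φ.exists_functional_eq_re_exp (hw j) (z j)
      refine ⟨H, fun t => ?_⟩
      rw [hH, ← Complex.re_ofReal_mul, Complex.ofReal_exp, mul_left_comm, ← Complex.exp_add, h,
        ← ha j]
      congr 3
      conv_lhs => rw [← Complex.re_add_im (w j)]
      push_cast
      ring
    · obtain ⟨H, hH⟩ := φ.exists_functional_eq_re_exp (hw j) ((starRingEnd ℂ) (z j))
      refine ⟨H, fun t => ?_⟩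
      rw [hH, ← Complex.conj_re, map_mul, Complex.conj_conj, ← Complex.exp_conj,
        ← Complex.re_ofReal_mul, Complex.ofReal_exp, mul_left_comm, ← Complex.exp_add, h, ← ha j]
      congr 3
      conv_lhs => rw [← Complex.re_add_im (w j)]
      simp only [map_mul, map_add, Complex.conj_ofReal, Complex.conj_I]
      push_cast
      ring
  choose H hH using hterm
  refine ⟨∑ j, H j, fun t => ?_⟩
  rw [LinearMap.sum_apply, Complex.re_sum, Finset.mul_sum]
  exact Finset.sum_congr rfl fun j _ => hH j t

theorem notMem_span_of_forall_isBenfordFunction {b : ℕ} (hb : 2 ≤ b)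
    (h : ∀ H : (X →L[ℝ] X) →ₗ[ℝ] ℝ,
      IsBenfordFunction b (fun t => H (φ.timeMap t)) ∨ ∀ t, H (φ.timeMap t) = 0)
    {z : ℂ} (hz : z ∈ φ.spectrum) :
    z.re / Real.log b ∉ Submodule.span ℚ (imDifferences φ.spectrum z.re) := by
  intro hmem
  let ι := {w : ℂ // w ∈ φ.spectrum ∧ w.re = z.re}
  have : Finite ι := (φ.finite_spectrum.subset fun w hw => hw.1 :
    {w : ℂ | w ∈ φ.spectrum ∧ w.re = z.re}.Finite)
  have : Fintype ι := Fintype.ofFinite ι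
  have : Nonempty ι := ⟨⟨z, hz, rfl⟩⟩
  obtain ⟨M, hM, p, hp⟩ := exists_int_combination_of_mem_span (η := fun w : ι => w.1.im)
    (Submodule.span_mono (by
      rintro x ⟨w, hw, w', hw', hre, hre', rfl⟩
      exact ⟨⟨w, hw, hre⟩, ⟨w', hw', hre'⟩, rfl⟩) hmem)
  -- Negative integer coefficients are moved into the sign of the frequency, making the exponents
  -- nonnegative. Doubling the relation makes their sum even.
  set η : ι → ℝ := fun w => if 0 ≤ p w then w.1.im else -w.1.im with hη
  have heven : Even (∑ w, 2 * (p w).natAbs) := by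
    rw [← Finset.mul_sum]
    exact even_two_mul _
  have hterm : ∀ w : ι, ((2 * (p w).natAbs : ℕ) : ℝ) * η w = 2 * (p w * w.1.im) := by
    intro w
    simp only [hη]
    push_cast
    rw [Nat.cast_natAbs]
    split_ifs with h0
    · rw [abs_of_nonneg h0]
      ring
    · rw [abs_of_neg (not_le.mp h0)]
      push_cast
      ring
  have hsum : 2 * π * (2 * M : ℤ) / Real.log b * z.re =
      ∑ w, ((2 * (p w).natAbs : ℕ) : ℝ) * η w := by
    simp_rw [hterm]
    rw [← Finset.mul_sum, ← hp]
    push_cast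
    ring
  obtain ⟨c, hc⟩ := exists_not_isBenfordFunction_of_resonance hb z.re η
    (fun w => 2 * (p w).natAbs) heven (mul_ne_zero two_ne_zero hM) hsum
  obtain ⟨H, hH⟩ := φ.exists_functional_eq_sum (w := fun w : ι => w.1) (fun w => w.2.1)
    (fun w => w.2.2) (η := η) (fun w => by simp only [hη]; split_ifs <;> simp) c
  have := h H
  simp_rw [hH] at this
  exact hc this

end LinearFlow

end

theorem theorem3p2 (b : ℕ) (hb : 2 ≤ b) (d : ℕ) (hd : 1 ≤ d)
    (φ : LinearFlow (EuclideanSpace ℝ (Fin d))) :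
    IsExpNonresonant b φ.spectrum ↔
      ∀ H : (EuclideanSpace ℝ (Fin d) →L[ℝ] EuclideanSpace ℝ (Fin d)) →ₗ[ℝ] ℝ,
        IsBenfordFunction b (fun t : ℝ => H (φ.timeMap t)) ∨ ∀ t : ℝ, H (φ.timeMap t) = 0 := by
  rw [isExpNonresonant_iff φ.finite_spectrum]
  refine ⟨fun h H => ?_, fun h z hz => φ.notMem_span_of_forall_isBenfordFunction hb h hz⟩
  by_cases h0 : ∀ t : ℝ, H (φ.timeMap t) = 0
  · exact Or.inr h0
  · exact Or.inl (φ.isBenfordFunction_functional hb h H (not_forall.mp h0))
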